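/- For $t\in\mathbb R$ let $\|t\|$ denote the distance from $t$ to the nearest integer. Let $0<i,j<1$ with $i+j=1$, and put $\sigma=\min\{i,j\}$. For $\boldsymbol\theta=(\gamma,\delta)\in\mathbb R^2$ let $\mathbf{Bad}_{\boldsymbol\theta}(i,j)$ be the set of points $(x,y)\in\mathbb R^2$ for which there is a constant $c=c(x,y)>0$ such that $$\max\{\|qx-\gamma\|^{1/i},\ \|qy-\delta\|^{1/j}\}>c\,q^{-1}\qquad\text{for all } q\in\mathbb N=\{1,2,3,\dots\}.$$ Schmidt's game. Let $X$ be $\mathbb R$ or a line in the Euclidean plane, and let $\alpha,\beta\in(0,1)$. Player $B$ chooses a closed ball $B_0\subset X$ of positive radius; then $A$ chooses a closed ball $A_0\subset B_0$ whose diameter is $\alpha$ times that of $B_0$, then $B$ chooses a closed ball $B_1\subset A_0$ whose diameter is $\beta$ times that of $A_0$, and so on. A set $S\subset X$ is $(\alpha,\beta)$-winning if $A$ can play so that, however $B$ plays, the unique point of $\bigcap_n B_n=\bigcap_n A_n$ lies in $S$; it is $\alpha$-winning if it is $(\alpha,\beta)$-winning for all $\beta\in(0,1)$, and winning if it is $\alpha$-winning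 for some $\alpha\in(0,1)$. Theorem. Let $a,b\in\mathbb R$ with $a\neq0$, and let $L_{a,b}=\{(x,y)\in\mathbb R^2: y=ax+b\}$. Suppose that there exists $\epsilon>0$ such that $$\liminf_{q\to\infty}\,q^{\frac1\sigma-\epsilon}\max\{\|qa\|,\|qb\|\}>0 .\qquad(*)$$ Then for every $\boldsymbol\theta\in\mathbb R^2$ the set $\mathbf{Bad}_{\boldsymbol\theta}(i,j)\cap L_{a,b}$ is a winning subset of $L_{a,b}$, and its projection to the $x$-axis is a $1/2$-winning subset of $\mathbb R$. If $a\in\mathbb Q$, then both conclusions also hold whenever $(*)$ holds with $\epsilon=0$. -/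

import Mathlib

open Filter Metric

/-- The distance `‖t‖` of a real number `t` to the nearest integer. -/
noncomputable def distInt (t : ℝ) : ℝ := |t - round t|

/-- The set of inhomogeneously `(i,j)`-badly approximable points of the plane, for the shift
`θ = (γ, δ) = (θ 0, θ 1)`. -/
def Bad (θ : EuclideanSpace ℝ (Fin 2)) (i j : ℝ) : Set (EuclideanSpace ℝ (Fin 2)) :=
  {p | ∃ c : ℝ, 0 < c ∧ ∀ q : ℕ, 0 < q →
    max (distInt (q * p 0 - θ 0) ^ (1 / i)) (distInt (q * p 1 - θ 1) ^ (1 / j)) > c / q}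

/-- The line `y = a x + b` in the Euclidean plane. -/
def line (a b : ℝ) : Set (EuclideanSpace ℝ (Fin 2)) :=
  {p | p 1 = a * p 0 + b}

/-- A move in Schmidt's game: a closed ball, given by its centre and its positive radius. -/
structure GameBall (X : Type*) where
  center : X
  radius : ℝ
  radius_pos : 0 < radius

/-- The closed ball as a set of points. -/
def GameBall.toSet {X : Type*} [MetricSpace X] (B : GameBall X) : Set X :=
  closedBall B.center B.radius

/-- `C` is a legal answer to `B` with ratio `t`: it is contained in `B` and its size is `t` times
that of `B`. (On the real line and on straight lines the diameter of a ball is twice its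
radius, so ratios of diameters and ratios of radii agree.) -/
def LegalMove {X : Type*} [MetricSpace X] (t : ℝ) (B C : GameBall X) : Prop :=
  C.toSet ⊆ B.toSet ∧ C.radius = t * B.radius

/-- The answer of player A, who follows the strategy `s`, in round `n`, when player B's balls are
`B 0, B 1, …`; it depends on `B 0, …, B n` only. -/
def answer {X : Type*} (s : List (GameBall X) → GameBall X) (B : ℕ → GameBall X) (n : ℕ) :
    GameBall X :=
  s ((List.range (n + 1)).map B)

/-- `S` is `(α,β)`-winning: player A has a strategy whose answers are legal as long as player B
has played legally, and such that in every infinite play in which B plays legally the unique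
common point of the balls lies in `S`. -/
def IsAlphaBetaWinning {X : Type*} [MetricSpace X] (α β : ℝ) (S : Set X) : Prop :=
  ∃ s : List (GameBall X) → GameBall X, ∀ B : ℕ → GameBall X,
    (∀ n, (∀ k < n, LegalMove β (answer s B k) (B (k + 1))) →
      LegalMove α (B n) (answer s B n)) ∧
    ((∀ n, LegalMove β (answer s B n) (B (n + 1))) →
      ∃ x ∈ S, ⋂ n, (B n).toSet = {x})

/-- `S` is `α`-winning: it is `(α,β)`-winning for all `β ∈ (0,1)`. -/
def IsAlphaWinning {X : Type*} [MetricSpace X] (α : ℝ) (S : Set X) : Prop :=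
  ∀ β : ℝ, 0 < β → β < 1 → IsAlphaBetaWinning α β S

/-- `S` is winning: it is `α`-winning for some `α ∈ (0,1)`. -/
def IsWinning {X : Type*} [MetricSpace X] (S : Set X) : Prop :=
  ∃ α : ℝ, 0 < α ∧ α < 1 ∧ IsAlphaWinning α S

/-- The Diophantine condition
`liminf_{q → ∞} q ^ (1/σ - ε) * max (‖q a‖, ‖q b‖) > 0`; the lower limit is taken in the extended
reals, as it may be `+∞`. -/
def DiophantineCondition (σ ε a b : ℝ) : Prop :=
  0 < liminf (fun q : ℕ =>
    (((q : ℝ) ^ (1 / σ - ε) * max (distInt (q * a)) (distInt (q * b)) : ℝ) : EReal)) atTop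

/-! The line is parametrized by a real `t`, with the coordinate of larger exponent first, and A
always answers with a left or right half. Going twice to the same side leaves out a middle interval
of length `β` times the radius, so an interval shorter than this can be reached from one side only.
Give each dangerous interval of radius `lam` the weight `lam ^ η`, with `η` so small that two rounds
shrink `radius ^ η` by a factor at least `3/4`. Taking the side of smaller total weight halves the
weight, which leaves room for new intervals at every scale: `isAlphaBetaWinning_of_isAvoidable`.

It remains to see that few intervals matter at each scale. Rational points with denominator about
`H` are dangerous on intervals of size `c / H ^ (1 + i)`. If a ball of size `T / H ^ (1 + i)` meets
two of them, the rational line through both points is nearly flat along the given line and stays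
within `c / H` of it on the whole ball (`lineForm_through_points`). By the Diophantine condition
such a line either cannot come so close or has slope at least `κ * H ^ (ε - 1)`; in the latter case
the set where it is close is itself short, and is declared dangerous too. Two dangerous lines of
comparable height and slope meet in a rational point of much smaller height, close to the whole ball
(`exists_closedBall_of_lineForm`). So points are localized by avoiding lines, and lines by avoiding
points. The apparent circle is harmless: localization only needs that the current ball lies in no
dangerous set, which is proved by induction along the play.

For a shift `θ`, the difference of two shifted points is an unshifted one. Avoiding the unshifted
points with constant `c` therefore localizes the shifted ones with a smaller constant `c₂`. -/

open Topology

/-! ### Schmidt's game played with halves of intervals -/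

/-- The left or the right half of a ball of the real line. -/
noncomputable def halfBall (left : Bool) (B : GameBall ℝ) : GameBall ℝ where
  center := if left then B.center - B.radius / 2 else B.center + B.radius / 2
  radius := B.radius / 2
  radius_pos := half_pos B.radius_pos

theorem GameBall.toSet_eq_Icc (B : GameBall ℝ) :
    B.toSet = Set.Icc (B.center - B.radius) (B.center + B.radius) :=
  Real.closedBall_eq_Icc

theorem legalMove_halfBall (left : Bool) (B : GameBall ℝ) :
    LegalMove (1 / 2) B (halfBall left B) := by
  have := B.radius_pos
  refine ⟨?_, by simp [halfBall]; ring⟩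
  rw [GameBall.toSet_eq_Icc, GameBall.toSet_eq_Icc]
  apply Set.Icc_subset_Icc <;> cases left <;> simp [halfBall] <;> linarith

theorem radius_of_legalMove_halfBall {β : ℝ} {d : ℕ → Bool} {B : ℕ → GameBall ℝ}
    (h : ∀ n, LegalMove β (halfBall (d n) (B n)) (B (n + 1))) (n : ℕ) :
    (B n).radius = (B 0).radius * (β / 2) ^ n := by
  induction n with
  | zero => simp
  | succ n ih =>
    rw [(h n).2]
    simp only [halfBall, ih]
    ring

theorem subset_of_legalMove_halfBall {β : ℝ} {d : ℕ → Bool} {B : ℕ → GameBall ℝ}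
    (h : ∀ n, LegalMove β (halfBall (d n) (B n)) (B (n + 1))) {m n : ℕ} (hmn : m ≤ n) :
    (B n).toSet ⊆ (B m).toSet :=
  antitone_nat_of_succ_le (f := fun n => (B n).toSet)
    (fun n => (h n).1.trans (legalMove_halfBall (d n) (B n)).1) hmn

/-- A rule that tells player A, at each round, which half to take yields a strategy for the
`(1/2, β)`-game. -/
theorem isAlphaBetaWinning_of_rule {β : ℝ} (hβ0 : 0 < β) (hβ1 : β < 1) {S : Set ℝ}
    (h : ∀ B₀ : GameBall ℝ, ∃ d : (ℕ → GameBall ℝ) → ℕ → Bool,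
      (∀ B B' n, (∀ m ≤ n, B m = B' m) → d B n = d B' n) ∧
      ∀ B, B 0 = B₀ → (∀ n, LegalMove β (halfBall (d B n) (B n)) (B (n + 1))) →
        ∀ x, (∀ n, x ∈ (B n).toSet) → x ∈ S) :
    IsAlphaBetaWinning (1 / 2) β S := by
  choose d hd hS using h
  -- The default fills the rounds not yet played; the rule at round `n` looks at rounds up to `n`
  -- only, so its value is irrelevant.
  let dflt : GameBall ℝ := ⟨0, 1, one_pos⟩
  let f : List (GameBall ℝ) → ℕ → GameBall ℝ := fun l t => l.getD t dflt
  let s : List (GameBall ℝ) → GameBall ℝ := fun l =>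
    halfBall (d (f l 0) (f l) (l.length - 1)) (f l (l.length - 1))
  have hf : ∀ (B : ℕ → GameBall ℝ) n, ∀ m ≤ n, f ((List.range (n + 1)).map B) m = B m := by
    intro B n m hm
    have : m < n + 1 := by omega
    simp only [f]
    rw [List.getD_eq_getElem _ _ (by simpa using this)]
    simp
  have hs : ∀ (B : ℕ → GameBall ℝ) n, answer s B n = halfBall (d (B 0) B n) (B n) := by
    intro B n
    have e1 : ((List.range (n + 1)).map B).length - 1 = n := by simp
    change halfBall (d (f ((List.range (n + 1)).map B) 0) (f ((List.range (n + 1)).map B))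
      (((List.range (n + 1)).map B).length - 1)) (f ((List.range (n + 1)).map B)
        (((List.range (n + 1)).map B).length - 1)) = _
    rw [e1, hf B n n le_rfl, hf B n 0 (Nat.zero_le n), hd (B 0) _ B n (hf B n)]
  refine ⟨s, fun B => ⟨fun n _ => ?_, fun hB => ?_⟩⟩
  · rw [hs]
    exact legalMove_halfBall _ _
  · simp only [hs] at hB
    have hr := radius_of_legalMove_halfBall hB
    have hsub := fun n => subset_of_legalMove_halfBall hB (Nat.le_succ n)
    have hlim : Tendsto (fun n => (B n).radius) atTop (nhds 0) := by
      rw [show (fun n => (B n).radius) = _ from funext hr]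
      have := (tendsto_pow_atTop_nhds_zero_of_lt_one (r := β / 2) (by positivity)
        (by linarith)).const_mul (B 0).radius
      simpa using this
    obtain ⟨x, hx⟩ : (⋂ n, (B n).toSet).Nonempty := by
      apply IsCompact.nonempty_iInter_of_sequence_nonempty_isCompact_isClosed _ hsub
      · exact fun n => nonempty_closedBall.2 (B n).radius_pos.le
      · exact isCompact_closedBall _ _
      · exact fun n => isClosed_closedBall
    have hx' := Set.mem_iInter.1 hx
    refine ⟨x, hS (B 0) B rfl hB x hx', ?_⟩
    refine Set.eq_singleton_iff_unique_mem.2 ⟨hx, fun y hy => ?_⟩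
    have hy' := Set.mem_iInter.1 hy
    have h1 : ∀ n, dist y x ≤ 2 * (B n).radius := fun n => by
      have h1 := mem_closedBall.1 (hy' n)
      have h2 := mem_closedBall'.1 (hx' n)
      linarith [dist_triangle y (B n).center x]
    have h2 : dist y x ≤ 2 * 0 := ge_of_tendsto' (hlim.const_mul 2) h1
    exact dist_le_zero.1 (by simpa using h2)

/-! ### The potential argument -/

/-- A countable collection of dangerous sets, divided into classes `k : K`, that player A can avoid
in the `(1/2, β)`-game that starts with the ball of centre `x₀` and radius `ρ₀`. The sets of class
`k` are dealt with when the current ball has radius `ρ₀ * ((β / 2) ^ 2) ^ stage k`. -/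
structure IsAvoidable (β x₀ ρ₀ η : ℝ) {K : Type} (stage : K → ℕ) (lam : K → ℝ)
    (D : K → Set (Set ℝ)) : Prop where
  η_pos : 0 < η
  le_rpow : 3 / 4 ≤ ((β / 2) ^ 2) ^ η
  lam_pos : ∀ k, 0 < lam k
  sum_le : ∀ n, ∑' k : {k | stage k = n}, ENNReal.ofReal (lam k ^ η) ≤
    ENNReal.ofReal ((β / 4) ^ η / 3 * (ρ₀ * ((β / 2) ^ 2) ^ n) ^ η)
  contained : ∀ k, ∀ E ∈ D k, ∃ z, E ⊆ closedBall z (lam k)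
  localized : ∀ k x, closedBall x (ρ₀ * ((β / 2) ^ 2) ^ stage k) ⊆ closedBall x₀ ρ₀ →
    (∀ k', ∀ E ∈ D k', ¬ closedBall x (ρ₀ * ((β / 2) ^ 2) ^ stage k) ⊆ E) →
    ∃ z, ∀ E ∈ D k, E ∩ closedBall x (ρ₀ * ((β / 2) ^ 2) ^ stage k) ⊆ closedBall z (lam k)

section Potential

variable {K : Type} (stage : K → ℕ) (lam : K → ℝ) (η : ℝ) (z : K → GameBall ℝ → ℝ)

/-- The ball of radius `lam k` in which the dangerous sets of class `k` have been localized. -/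
def dangerBall (B : ℕ → GameBall ℝ) (k : K) : Set ℝ :=
  closedBall (z k (B (2 * stage k))) (lam k)

/-- The total weight of the classes revealed up to stage `N` that threaten the set `U`. -/
noncomputable def potential (B : ℕ → GameBall ℝ) (N : ℕ) (U : Set ℝ) : ENNReal :=
  ∑' k : {k | stage k ≤ N ∧ (dangerBall stage lam z B k ∩ U).Nonempty}, ENNReal.ofReal (lam k ^ η)

/-- The part of `B` that remains reachable if A takes twice the left half, or twice the right
half. -/
def reach (β : ℝ) (left : Bool) (B : GameBall ℝ) : Set ℝ :=
  if left then Set.Icc (B.center - B.radius) (B.center - B.radius * β / 2)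
  else Set.Icc (B.center + B.radius * β / 2) (B.center + B.radius)

open Classical in
/-- The half to be taken in round `n`: the one with the smaller potential. -/
noncomputable def direction (β : ℝ) (B : ℕ → GameBall ℝ) (n : ℕ) : Bool :=
  decide (potential stage lam η z B (n / 2) (reach β true (B (2 * (n / 2)))) ≤
    potential stage lam η z B (n / 2) (reach β false (B (2 * (n / 2)))))

variable {stage lam η z}

theorem potential_congr {B B' : ℕ → GameBall ℝ} {N : ℕ} (h : ∀ m ≤ 2 * N, B m = B' m)
    (U : Set ℝ) : potential stage lam η z B N U = potential stage lam η z B' N U := by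
  have : {k | stage k ≤ N ∧ (dangerBall stage lam z B k ∩ U).Nonempty} =
      {k | stage k ≤ N ∧ (dangerBall stage lam z B' k ∩ U).Nonempty} := by
    ext k
    refine and_congr_right fun hk => ?_
    rw [dangerBall, dangerBall, h _ (by omega)]
  unfold potential
  rw [this]

theorem direction_congr {β : ℝ} {B B' : ℕ → GameBall ℝ} {n : ℕ} (h : ∀ m ≤ n, B m = B' m) :
    direction stage lam η z β B n = direction stage lam η z β B' n := by
  have h' : ∀ m ≤ 2 * (n / 2), B m = B' m := fun m hm => h m (by omega)
  simp only [direction, potential_congr h', h' _ le_rfl]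

theorem potential_mono (B : ℕ → GameBall ℝ) (N : ℕ) {U V : Set ℝ} (h : U ⊆ V) :
    potential stage lam η z B N U ≤ potential stage lam η z B N V :=
  ENNReal.tsum_mono_subtype (fun k => ENNReal.ofReal (lam k ^ η)) fun _ hk =>
    ⟨hk.1, hk.2.mono (Set.inter_subset_inter_right _ h)⟩

theorem potential_succ_le (B : ℕ → GameBall ℝ) (N : ℕ) (U : Set ℝ) :
    potential stage lam η z B (N + 1) U ≤ potential stage lam η z B N U +
      ∑' k : {k | stage k = N + 1}, ENNReal.ofReal (lam k ^ η) := by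
  refine le_trans (ENNReal.tsum_mono_subtype (fun k => ENNReal.ofReal (lam k ^ η))
    (t := _ ∪ {k | stage k = N + 1}) ?_)
    (ENNReal.tsum_union_le (fun k => ENNReal.ofReal (lam k ^ η)) _ _)
  rintro k ⟨hk, hU⟩
  rcases Nat.le_succ_iff.1 hk with h | h
  · exact Or.inl ⟨h, hU⟩
  · exact Or.inr h

theorem le_potential {B : ℕ → GameBall ℝ} {N : ℕ} {U : Set ℝ} {k : K} (hk : stage k ≤ N)
    (hU : (dangerBall stage lam z B k ∩ U).Nonempty) :
    ENNReal.ofReal (lam k ^ η) ≤ potential stage lam η z B N U :=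
  ENNReal.le_tsum (f := fun k : {k | stage k ≤ N ∧ (dangerBall stage lam z B k ∩ U).Nonempty} =>
    ENNReal.ofReal (lam k ^ η)) ⟨k, hk, hU⟩

theorem reach_subset {β : ℝ} (hβ0 : 0 < β) (left : Bool) (B : GameBall ℝ) :
    reach β left B ⊆ B.toSet := by
  have := mul_pos B.radius_pos hβ0
  have := B.radius_pos
  rw [GameBall.toSet_eq_Icc]
  cases left <;> simp only [reach, if_true, Bool.false_eq_true, if_false] <;>
    apply Set.Icc_subset_Icc <;> linarith

/-- The two reachable parts are separated by a gap of length `C.radius * β`, longer than the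
diameter of any danger ball counted, so no class is counted on both sides. -/
theorem potential_reach_add_le {β : ℝ} (hβ0 : 0 < β) {B : ℕ → GameBall ℝ} {N : ℕ}
    {C : GameBall ℝ}
    (hlam : ∀ k, stage k ≤ N → (dangerBall stage lam z B k ∩ C.toSet).Nonempty →
      2 * lam k < C.radius * β) :
    potential stage lam η z B N (reach β true C) + potential stage lam η z B N (reach β false C) ≤
      potential stage lam η z B N C.toSet := by
  unfold potential
  rw [← Summable.tsum_union_disjoint (f := fun k => ENNReal.ofReal (lam k ^ η)) _
    ENNReal.summable ENNReal.summable]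
  · refine ENNReal.tsum_mono_subtype (fun k => ENNReal.ofReal (lam k ^ η))
      (Set.union_subset ?_ ?_) <;>
      exact fun k hk => ⟨hk.1, hk.2.mono (Set.inter_subset_inter_right _ (reach_subset hβ0 _ _))⟩
  · rw [Set.disjoint_left]
    rintro k ⟨hk, y, hy, hy'⟩ ⟨-, w, hw, hw'⟩
    have h1 := hlam k hk ⟨y, hy, reach_subset hβ0 _ _ hy'⟩
    simp only [reach, if_true, Bool.false_eq_true, if_false, Set.mem_Icc, dangerBall,
      Real.closedBall_eq_Icc] at hy hy' hw hw'
    linarith [hy.1, hy.2, hy'.1, hy'.2, hw.1, hw.2, hw'.1, hw'.2]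

/-- `B₁` lies on one side of the centre of `B₀` and has radius `β / 2` times that of `B₀`, so its
own centre is at least that far from the centre of `B₀`. The second half on the same side stops at
the centre of `B₁`. -/
theorem toSet_subset_reach {β : ℝ} {left : Bool} {B₀ B₁ B₂ : GameBall ℝ}
    (h₁ : LegalMove β (halfBall left B₀) B₁) (h₂ : LegalMove β (halfBall left B₁) B₂) :
    B₂.toSet ⊆ reach β left B₀ := by
  refine h₂.1.trans ?_
  have e := h₁.2
  have hs := h₁.1
  have hr := B₁.radius_pos
  rw [GameBall.toSet_eq_Icc, GameBall.toSet_eq_Icc, Set.Icc_subset_Icc_iff (by linarith)] at hs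
  rw [GameBall.toSet_eq_Icc]
  cases left <;> simp only [reach, halfBall, if_true, Bool.false_eq_true, if_false] at e hs ⊢ <;>
    apply Set.Icc_subset_Icc <;> linarith [hs.1, hs.2]

end Potential

/-- Player A can avoid the dangerous sets. -/
theorem isAlphaBetaWinning_of_isAvoidable {β : ℝ} (hβ0 : 0 < β) (hβ1 : β < 1) {S : Set ℝ}
    (h : ∀ x₀ ρ₀ : ℝ, 0 < ρ₀ → ∃ (K : Type) (stage : K → ℕ) (lam : K → ℝ) (η : ℝ)
      (D : K → Set (Set ℝ)), IsAvoidable β x₀ ρ₀ η stage lam D ∧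
        ∀ x ∈ closedBall x₀ ρ₀, (∀ k, ∀ E ∈ D k, x ∉ E) → x ∈ S) :
    IsAlphaBetaWinning (1 / 2) β S := by
  apply isAlphaBetaWinning_of_rule hβ0 hβ1
  intro B₀
  obtain ⟨K, stage, lam, η, D, hD, hS⟩ := h B₀.center B₀.radius B₀.radius_pos
  -- The localizing centre is made a function of the class and of the ball at its stage, so that the
  -- rule looks only at balls already played. Where localization does not apply, the centre is
  -- arbitrary.
  have hz : ∀ k (C : GameBall ℝ), ∃ w, C.radius = B₀.radius * ((β / 2) ^ 2) ^ stage k →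
      C.toSet ⊆ B₀.toSet → (∀ k', ∀ E ∈ D k', ¬ C.toSet ⊆ E) →
      ∀ E ∈ D k, E ∩ C.toSet ⊆ closedBall w (lam k) := by
    intro k C
    by_cases hC : C.radius = B₀.radius * ((β / 2) ^ 2) ^ stage k ∧ C.toSet ⊆ B₀.toSet ∧
      ∀ k', ∀ E ∈ D k', ¬ C.toSet ⊆ E
    · obtain ⟨h1, h2, h3⟩ := hC
      simp only [GameBall.toSet, h1] at h2 h3 ⊢
      obtain ⟨w, hw⟩ := hD.localized k C.center h2 h3
      exact ⟨w, fun _ _ _ => hw⟩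
    · exact ⟨0, fun h1 h2 h3 => absurd ⟨h1, h2, h3⟩ hC⟩
  choose z hz using hz
  refine ⟨direction stage lam η z β, fun B B' n => direction_congr, ?_⟩
  rintro B rfl hB x hx
  have hr : ∀ n, (B (2 * n)).radius = (B 0).radius * ((β / 2) ^ 2) ^ n := fun n => by
    rw [radius_of_legalMove_halfBall hB, pow_mul]
  have hη := hD.η_pos
  have hradius := fun n => (B n).radius_pos
  have hw_pos : ∀ k, 0 < lam k ^ η := fun k => Real.rpow_pos_of_pos (hD.lam_pos k) _
  -- a class that has potential at most that of the ball is short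
  have hshort : ∀ k n, ENNReal.ofReal (lam k ^ η) ≤
      ENNReal.ofReal ((β / 4) ^ η * (B (2 * n)).radius ^ η) →
        lam k ≤ β / 4 * (B (2 * n)).radius := by
    intro k n hk
    have := hradius (2 * n)
    rw [ENNReal.ofReal_le_ofReal_iff (by positivity), ← Real.mul_rpow (by positivity)
      (by positivity)] at hk
    exact (Real.rpow_le_rpow_iff (hD.lam_pos k).le (by positivity) hη).1 hk
  have hstage : ∀ k, lam k < (B (2 * stage k)).radius := by
    intro k
    have h1 := (ENNReal.le_tsum (f := fun k' : {k' | stage k' = stage k} =>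
      ENNReal.ofReal (lam k' ^ η)) ⟨k, rfl⟩).trans (hD.sum_le (stage k))
    have h2 : 0 < (B (2 * stage k)).radius := hradius _
    have h3 := hshort k (stage k) (h1.trans (ENNReal.ofReal_le_ofReal (by
      rw [← hr]
      have : 0 ≤ (β / 4) ^ η * (B (2 * stage k)).radius ^ η := by positivity
      linarith)))
    nlinarith
  -- Two rounds halve the old potential and add at most a third of the new bound; `1/2 + r ^ η / 3 ≤
  -- r ^ η` for `r = (β / 2) ^ 2`, since `3/4 ≤ r ^ η`.
  have key : ∀ n, potential stage lam η z B n (B (2 * n)).toSet ≤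
      ENNReal.ofReal ((β / 4) ^ η * (B (2 * n)).radius ^ η) := by
    intro n
    induction n with
    | zero =>
      refine le_trans (ENNReal.tsum_mono_subtype (fun k => ENNReal.ofReal (lam k ^ η))
        (t := {k | stage k = 0}) fun k hk =>
        Nat.le_zero.1 hk.1) ((hD.sum_le 0).trans (ENNReal.ofReal_le_ofReal ?_))
      have := hradius 0
      have : 0 ≤ (β / 4) ^ η * (B 0).radius ^ η := by positivity
      simp only [pow_zero, mul_one, mul_zero]
      linarith
    | succ n ih =>
      have hhalf : potential stage lam η z B n (B (2 * (n + 1))).toSet ≤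
          ENNReal.ofReal ((β / 4) ^ η * (B (2 * n)).radius ^ η) / 2 := by
        have hd : direction stage lam η z β B (2 * n + 1) = direction stage lam η z β B (2 * n) := by
          simp only [direction, show (2 * n + 1) / 2 = 2 * n / 2 by omega]
        have h1 := hB (2 * n)
        have h2 := hB (2 * n + 1)
        rw [hd] at h2
        have hsub := toSet_subset_reach h1 h2
        have hadd := potential_reach_add_le (η := η) (stage := stage) (lam := lam) (z := z) (B := B)
          (N := n) (C := B (2 * n)) hβ0 (fun k hk hne => by
            have h3 := hshort k n ((le_potential hk hne).trans ih)
            have := hradius (2 * n)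
            nlinarith)
        replace hadd := hadd.trans ih
        rw [ENNReal.le_div_iff_mul_le (by simp) (by simp), mul_two]
        refine le_trans ?_ hadd
        refine (add_le_add (potential_mono B n hsub) (potential_mono B n hsub)).trans ?_
        by_cases hc : potential stage lam η z B n (reach β true (B (2 * n))) ≤
            potential stage lam η z B n (reach β false (B (2 * n)))
        · have : direction stage lam η z β B (2 * n) = true := by
            simp only [direction, show 2 * n / 2 = n by omega, hc, decide_true]
          rw [this]
          gcongr
        · have : direction stage lam η z β B (2 * n) = false := by
            simp only [direction, show 2 * n / 2 = n by omega, hc, decide_false]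
          rw [this]
          have hc' := (not_le.1 hc).le
          gcongr
      refine (potential_succ_le B n _).trans ((add_le_add hhalf (hD.sum_le (n + 1))).trans ?_)
      have h0 := hradius (2 * n)
      have e : (B (2 * (n + 1))).radius = (β / 2) ^ 2 * (B (2 * n)).radius := by
        rw [hr, hr]; ring
      rw [← hr, e, Real.mul_rpow (by positivity) h0.le,
        show (2 : ENNReal) = ENNReal.ofReal 2 by simp,
        ← ENNReal.ofReal_div_of_pos (by norm_num), ← ENNReal.ofReal_add (by positivity)
          (by positivity)]
      apply ENNReal.ofReal_le_ofReal
      have h1 : 0 ≤ (β / 4) ^ η * (B (2 * n)).radius ^ η := by positivity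
      have h2 := hD.le_rpow
      nlinarith
  -- A set containing the ball has `lam k` at least its radius, so its stage is past. By induction
  -- the set was then localized correctly, so its class is counted in the potential, whose bound
  -- makes `lam k` smaller than the radius.
  have hcover : ∀ n k, ∀ E ∈ D k, ¬ (B (2 * n)).toSet ⊆ E := by
    intro n
    induction n using Nat.strong_induction_on with
    | _ n ih =>
      intro k E hE hsub
      obtain ⟨w, hw⟩ := hD.contained k E hE
      have hle : ∀ w', (B (2 * n)).toSet ⊆ closedBall w' (lam k) → (B (2 * n)).radius ≤ lam k := by
        intro w' h1
        have := hradius (2 * n)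
        rw [GameBall.toSet_eq_Icc, Real.closedBall_eq_Icc, Set.Icc_subset_Icc_iff (by linarith)] at h1
        linarith [h1.1, h1.2]
      have h1 := hle w (hsub.trans hw)
      have hlt : stage k < n := by
        by_contra! hge
        have h2 : (B (2 * stage k)).radius ≤ (B (2 * n)).radius := by
          rw [hr, hr]
          apply mul_le_mul_of_nonneg_left _ (hradius 0).le
          exact pow_le_pow_of_le_one (by positivity) (by nlinarith) hge
        linarith [hstage k]
      have h3 := hz k (B (2 * stage k)) (hr _) (subset_of_legalMove_halfBall hB (Nat.zero_le _))
        (ih _ hlt) E hE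
      have h4 : (B (2 * n)).toSet ⊆ dangerBall stage lam z B k :=
        fun y hy => h3 ⟨hsub hy, subset_of_legalMove_halfBall hB (by omega) hy⟩
      have h5 := hshort k n ((le_potential hlt.le ⟨x, h4 (hx _), hx _⟩).trans (key n))
      have := hradius (2 * n)
      nlinarith
  refine hS x (hx 0) fun k E hE hxE => ?_
  have hxk : x ∈ dangerBall stage lam z B k :=
    hz k (B (2 * stage k)) (hr _) (subset_of_legalMove_halfBall hB (Nat.zero_le _))
      (hcover _) E hE ⟨hxE, hx _⟩
  -- A danger ball containing the limit point is counted at every later stage, so the invariant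
  -- bounds `lam k` by radii tending to `0`.
  have hle : ∀ n, lam k ≤ β / 4 * ((B 0).radius * ((β / 2) ^ 2) ^ (n + stage k)) := fun n => by
    rw [← hr]
    exact hshort k _ ((le_potential (Nat.le_add_left _ _) ⟨x, hxk, hx _⟩).trans (key _))
  have hlim : Tendsto (fun n => β / 4 * ((B 0).radius * ((β / 2) ^ 2) ^ (n + stage k))) atTop
      (nhds (β / 4 * ((B 0).radius * 0))) := by
    refine ((((tendsto_pow_atTop_nhds_zero_of_lt_one (by positivity) ?_).comp
      (tendsto_add_atTop_nat (stage k)))).const_mul _).const_mul _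
    nlinarith
  have := ge_of_tendsto' hlim hle
  simp only [mul_zero] at this
  linarith [hD.lam_pos k]

/-! ### Dangerous points and lines, and their localization -/

/-- The parameters `t` for which the point `(a₁ t + b₁, a₂ t + b₂)` is close to the shifted rational
point `((p + γ) / q, (r + δ) / q)`. -/
def pointSet (a₁ b₁ a₂ b₂ γ δ c X Y : ℝ) (p r q : ℤ) : Set ℝ :=
  {t | |q * (a₁ * t + b₁) - γ - p| ≤ c / X ∧ |q * (a₂ * t + b₂) - δ - r| ≤ c / Y}

/-- The restriction of the form `A x + B y + C` to the line `t ↦ (a₁ t + b₁, a₂ t + b₂)`. -/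
def lineForm (a₁ b₁ a₂ b₂ : ℝ) (A B C : ℤ) (t : ℝ) : ℝ :=
  A * (a₁ * t + b₁) + B * (a₂ * t + b₂) + C

/-- The set attached to a shifted rational point is contained in a short interval. -/
theorem pointSet_subset_closedBall {a₁ b₁ a₂ b₂ γ δ c G X Y : ℝ} (ha₁ : 1 ≤ G * |a₁|)
    (hX : 0 < X) (hY : 0 < Y) {p r q : ℤ} (hq : X * Y ≤ q) :
    pointSet a₁ b₁ a₂ b₂ γ δ c X Y p r q ⊆
      closedBall (((p + γ) / q - b₁) / a₁) (c * G / (X * Y * X)) := by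
  intro t h
  have ha₁n : a₁ ≠ 0 := by
    rintro rfl
    norm_num at ha₁
  have hG : 0 ≤ G := by
    by_contra! h
    nlinarith [abs_nonneg a₁]
  have hq0 : (0 : ℝ) < q := lt_of_lt_of_le (by positivity) hq
  have e : q * a₁ * (t - ((p + γ) / q - b₁) / a₁) = q * (a₁ * t + b₁) - γ - p := by
    field_simp
    ring
  rw [mem_closedBall, Real.dist_eq]
  have h1 := h.1
  rw [← e, abs_mul, abs_mul, abs_of_pos hq0, le_div_iff₀ hX] at h1
  rw [le_div_iff₀ (by positivity)]
  have h2 : |t - ((p + γ) / q - b₁) / a₁| * (X * Y * X) * 1 ≤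
      |t - ((p + γ) / q - b₁) / a₁| * (q * X) * (G * |a₁|) := by gcongr
  nlinarith

/-- The set attached to a line is contained in a short interval. -/
theorem lineForm_subset_closedBall {a₁ b₁ a₂ b₂ c R S H : ℝ} (hR : 0 < R) (hS : 0 < S)
    (hH : 0 < H) {A B C : ℤ} (hs : S / R < |a₁ * A + a₂ * B|) :
    {t | |lineForm a₁ b₁ a₂ b₂ A B C t| ≤ c / H} ⊆
      closedBall (-(A * b₁ + B * b₂ + C) / (a₁ * A + a₂ * B)) (c * R / (H * S)) := by
  intro t h
  have hσ : a₁ * A + a₂ * B ≠ 0 := abs_pos.1 (lt_of_le_of_lt (by positivity) hs)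
  have e : (a₁ * A + a₂ * B) * (t - -(A * b₁ + B * b₂ + C) / (a₁ * A + a₂ * B)) =
      lineForm a₁ b₁ a₂ b₂ A B C t := by
    simp only [lineForm]
    field_simp
    ring
  rw [mem_closedBall, Real.dist_eq]
  rw [Set.mem_ofPred_eq, ← e, abs_mul, le_div_iff₀ hH] at h
  rw [le_div_iff₀ (by positivity)]
  rw [div_lt_iff₀ hR] at hs
  calc _ = |t - -(A * b₁ + B * b₂ + C) / (a₁ * A + a₂ * B)| * H * S := by ring
    _ ≤ |t - -(A * b₁ + B * b₂ + C) / (a₁ * A + a₂ * B)| * H *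
        (|a₁ * A + a₂ * B| * R) := by gcongr
    _ = |a₁ * A + a₂ * B| * |t - -(A * b₁ + B * b₂ + C) / (a₁ * A + a₂ * B)| * H * R := by ring
    _ ≤ c * R := by gcongr

/-- Moving `t` inside the ball changes the error by at most `q * |a| * 2ρ ≤ 2 * G ^ 2 * T / X`.
Closeness at one parameter thus spreads to the whole ball, at the price of replacing `c` by a
multiple of `T`. -/
theorem abs_le_of_mem_closedBall {a b γ c G H T X ρ x s t : ℝ} {p q : ℤ} (ha : |a| ≤ G)
    (hG : 1 ≤ G) (hX : 0 < X) (hH : 0 < H) (hc : c ≤ T) (hρ : ρ * (H * X) ≤ T)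
    (hq : 0 ≤ q) (hqH : q ≤ G * H) (hs : s ∈ closedBall x ρ) (ht : t ∈ closedBall x ρ)
    (h : |q * (a * s + b) - γ - p| ≤ c / X) : |q * (a * t + b) - γ - p| ≤ 3 * G ^ 2 * T / X := by
  rw [mem_closedBall, Real.dist_eq] at hs ht
  have hst : |t - s| ≤ 2 * ρ := by
    have := abs_sub_le t x s
    rw [abs_sub_comm x s] at this
    linarith
  have hρ0 : 0 ≤ ρ := (abs_nonneg _).trans ht
  have hq' : (0 : ℝ) ≤ q := by exact_mod_cast hq
  have hT : 0 ≤ T := (by positivity : 0 ≤ ρ * (H * X)).trans hρ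
  have e : q * (a * t + b) - γ - p = (q * (a * s + b) - γ - p) + q * a * (t - s) := by ring
  rw [e]
  refine (abs_add_le _ _).trans ?_
  rw [abs_mul, abs_mul, abs_of_nonneg hq']
  have h1 : (q : ℝ) * |a| * |t - s| ≤ (G * H) * G * (2 * ρ) := by gcongr
  have h2 : ρ ≤ T / (H * X) := by rwa [le_div_iff₀ (by positivity)]
  have h3 : (G * H) * G * (2 * ρ) ≤ (G * H) * G * (2 * (T / (H * X))) := by gcongr
  have h4 : (G * H) * G * (2 * (T / (H * X))) = 2 * G ^ 2 * T / X := by field_simp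
  have h5 : c / X ≤ 1 ^ 2 * T / X := by gcongr; linarith
  have h6 : 1 ^ 2 * T / X ≤ G ^ 2 * T / X := by gcongr
  have h7 : 3 * G ^ 2 * T / X = 2 * G ^ 2 * T / X + G ^ 2 * T / X := by ring
  linarith

theorem abs_mul_sub_mul_le {a b c d e f g h : ℝ} (ha : |a| ≤ e) (hb : |b| ≤ f) (hc : |c| ≤ g)
    (hd : |d| ≤ h) : |a * b - c * d| ≤ e * f + g * h := by
  refine (abs_sub _ _).trans ?_
  rw [abs_mul, abs_mul]
  have := (abs_nonneg a).trans ha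
  have := (abs_nonneg c).trans hc
  gcongr

/-- The line through two rational points close to the given line is flat with respect to it. -/
theorem lineForm_through_points {a₁ b₁ a₂ b₂ c G T X Y ρ x t₁ t₂ : ℝ} {p₁ r₁ q₁ p₂ r₂ q₂ : ℤ}
    (ha₁ : |a₁| ≤ G) (ha₂ : |a₂| ≤ G) (hG : 4 ≤ G) (hY : 1 ≤ Y) (hYX : Y ≤ X) (hc : 0 < c)
    (hcT : c ≤ T) (hT : 6 * G ^ 3 * T ≤ 1) (hρ : ρ * (X * Y * X) ≤ T)
    (hq₁ : 0 ≤ q₁) (hq₁' : q₁ ≤ G * (X * Y)) (hq₂ : 0 ≤ q₂) (hq₂' : q₂ ≤ G * (X * Y))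
    (ht₁ : t₁ ∈ closedBall x ρ) (ht₂ : t₂ ∈ closedBall x ρ)
    (h₁ : t₁ ∈ pointSet a₁ b₁ a₂ b₂ 0 0 c X Y p₁ r₁ q₁)
    (h₂ : t₂ ∈ pointSet a₁ b₁ a₂ b₂ 0 0 c X Y p₂ r₂ q₂) :
    |((r₁ * q₂ - q₁ * r₂ : ℤ) : ℝ)| ≤ X ∧ |((q₁ * p₂ - p₁ * q₂ : ℤ) : ℝ)| ≤ Y ∧
    |a₁ * (r₁ * q₂ - q₁ * r₂ : ℤ) + a₂ * (q₁ * p₂ - p₁ * q₂ : ℤ)| ≤ 4 * G ^ 2 * c * X ∧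
    ∀ t ∈ closedBall x ρ, |lineForm a₁ b₁ a₂ b₂ (r₁ * q₂ - q₁ * r₂) (q₁ * p₂ - p₁ * q₂)
      (p₁ * r₂ - r₁ * p₂) t| ≤ c / (X * Y) := by
  have hX0 : 0 < X := by linarith
  have hY0 : 0 < Y := by linarith
  have hT0 : 0 < T := by linarith
  have hG0 : 0 < G := by linarith
  have hρ0 : 0 ≤ ρ := dist_nonneg.trans (mem_closedBall.1 ht₁)
  have hρY : ρ * (X * Y * Y) ≤ T := le_trans (by gcongr) hρ
  have hq₁0 : (0 : ℝ) ≤ q₁ := by exact_mod_cast hq₁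
  have hq₂0 : (0 : ℝ) ≤ q₂ := by exact_mod_cast hq₂
  have aq₁ : |(q₁ : ℝ)| ≤ G * (X * Y) := by rwa [abs_of_nonneg hq₁0]
  have aq₂ : |(q₂ : ℝ)| ≤ G * (X * Y) := by rwa [abs_of_nonneg hq₂0]
  have hu₁ : ∀ t ∈ closedBall x ρ, |q₁ * (a₁ * t + b₁) - 0 - p₁| ≤ 3 * G ^ 2 * T / X := fun t ht =>
    abs_le_of_mem_closedBall ha₁ (by linarith) hX0 (by positivity) hcT hρ hq₁ hq₁' ht₁ ht h₁.1
  have hu₂ : ∀ t ∈ closedBall x ρ, |q₂ * (a₁ * t + b₁) - 0 - p₂| ≤ 3 * G ^ 2 * T / X := fun t ht =>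
    abs_le_of_mem_closedBall ha₁ (by linarith) hX0 (by positivity) hcT hρ hq₂ hq₂' ht₂ ht h₂.1
  have hw₁ : ∀ t ∈ closedBall x ρ, |q₁ * (a₂ * t + b₂) - 0 - r₁| ≤ 3 * G ^ 2 * T / Y := fun t ht =>
    abs_le_of_mem_closedBall ha₂ (by linarith) hY0 (by positivity) hcT hρY hq₁ hq₁' ht₁ ht h₁.2
  have hw₂ : ∀ t ∈ closedBall x ρ, |q₂ * (a₂ * t + b₂) - 0 - r₂| ≤ 3 * G ^ 2 * T / Y := fun t ht =>
    abs_le_of_mem_closedBall ha₂ (by linarith) hY0 (by positivity) hcT hρY hq₂ hq₂' ht₂ ht h₂.2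
  -- The combination of the two errors of a point with coefficients `a₂` and `-a₁` does not depend
  -- on `t`. It can be evaluated where that point is closest, which puts `c` and not `T` into the
  -- bound.
  have hslope : |a₁ * (r₁ * q₂ - q₁ * r₂ : ℤ) + a₂ * (q₁ * p₂ - p₁ * q₂ : ℤ)| ≤
      4 * G ^ 2 * c * X := by
    have hcXY : c / X ≤ c / Y := by gcongr
    have hv₁ := abs_mul_sub_mul_le ha₂ h₁.1 ha₁ h₁.2
    have hv₂ := abs_mul_sub_mul_le ha₂ h₂.1 ha₁ h₂.2
    have hle : G * (c / X) + G * (c / Y) ≤ 2 * G * (c / Y) := by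
      have : G * (c / X) ≤ G * (c / Y) := by gcongr
      linarith
    have := abs_mul_sub_mul_le aq₂ (hv₁.trans hle) aq₁ (hv₂.trans hle)
    have e : G * (X * Y) * (2 * G * (c / Y)) + G * (X * Y) * (2 * G * (c / Y)) =
        4 * G ^ 2 * c * X := by field_simp; ring
    rw [e] at this
    convert this using 2
    push_cast
    ring
  refine ⟨?_, ?_, hslope, fun t ht => ?_⟩
  · have := abs_mul_sub_mul_le aq₁ (hw₂ t₁ ht₁) aq₂ (hw₁ t₁ ht₁)
    have e : G * (X * Y) * (3 * G ^ 2 * T / Y) + G * (X * Y) * (3 * G ^ 2 * T / Y) =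
        6 * G ^ 3 * T * X := by field_simp; ring
    rw [e] at this
    refine le_trans (le_of_eq ?_) (this.trans (mul_le_of_le_one_left hX0.le hT))
    congr 1
    push_cast
    ring
  · have := abs_mul_sub_mul_le aq₂ (hu₁ t₁ ht₁) aq₁ (hu₂ t₁ ht₁)
    have e : G * (X * Y) * (3 * G ^ 2 * T / X) + G * (X * Y) * (3 * G ^ 2 * T / X) =
        6 * G ^ 3 * T * Y := by field_simp; ring
    rw [e] at this
    refine le_trans (le_of_eq ?_) (this.trans (mul_le_of_le_one_left hY0.le hT))
    congr 1
    push_cast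
    ring
  -- At `t₁` the form is the determinant of the two error vectors, the first of which is of size `c`
  -- there. The small slope carries the bound to the rest of the ball.
  · have h0 := abs_mul_sub_mul_le h₁.1 (hw₂ t₁ ht₁) h₁.2 (hu₂ t₁ ht₁)
    have e : c / X * (3 * G ^ 2 * T / Y) + c / Y * (3 * G ^ 2 * T / X) =
        6 * G ^ 2 * T * (c / (X * Y)) := by field_simp; ring
    rw [e] at h0
    have hst : |t - t₁| ≤ 2 * ρ := by
      rw [mem_closedBall, Real.dist_eq] at ht ht₁
      have := abs_sub_le t x t₁
      rw [abs_sub_comm x t₁] at this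
      linarith
    have hρ' : ρ ≤ T / (X * Y * X) := by rwa [le_div_iff₀ (by positivity)]
    have h1 : |(a₁ * (r₁ * q₂ - q₁ * r₂ : ℤ) + a₂ * (q₁ * p₂ - p₁ * q₂ : ℤ)) * (t - t₁)| ≤
        8 * G ^ 2 * T * (c / (X * Y)) := by
      rw [abs_mul]
      calc _ ≤ 4 * G ^ 2 * c * X * (2 * (T / (X * Y * X))) := by
            gcongr; linarith
        _ = _ := by field_simp; ring
    have h2 := (abs_add_le _ _).trans (add_le_add h0 h1)
    have h3 : 6 * G ^ 2 * T * (c / (X * Y)) + 8 * G ^ 2 * T * (c / (X * Y)) ≤ c / (X * Y) := by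
      have : 14 * G ^ 2 * T ≤ 6 * G ^ 3 * T := by
        have : 0 < G ^ 2 * T := by positivity
        nlinarith
      rw [← add_mul]
      refine mul_le_of_le_one_left (by positivity) (by linarith)
    refine le_trans (le_of_eq ?_) (h2.trans h3)
    congr 1
    simp only [lineForm]
    push_cast
    ring

/-- Nearby rational points of comparable height that are not on a dangerous line coincide. -/
theorem exists_closedBall_of_pointSet {a₁ b₁ a₂ b₂ c G T X Y ρ x : ℝ}
    (ha₁ : |a₁| ≤ G) (ha₁' : 1 ≤ G * |a₁|) (ha₂ : |a₂| ≤ G) (hG : 4 ≤ G) (hY : 1 ≤ Y) (hYX : Y ≤ X)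
    (hc : 0 < c) (hcT : c ≤ T) (hT : 6 * G ^ 3 * T ≤ 1) (hρ : ρ * (X * Y * X) ≤ T)
    (hline : ∀ A B C : ℤ, |(A : ℝ)| ≤ X → |(B : ℝ)| ≤ Y → |a₁ * A + a₂ * B| ≤ 4 * G ^ 2 * c * X →
      ¬ (A = 0 ∧ B = 0) → ¬ ∀ t ∈ closedBall x ρ, |lineForm a₁ b₁ a₂ b₂ A B C t| ≤ c / (X * Y)) :
    ∃ z, ∀ p r q : ℤ, X * Y ≤ q → q ≤ G * (X * Y) →
      pointSet a₁ b₁ a₂ b₂ 0 0 c X Y p r q ∩ closedBall x ρ ⊆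
        closedBall z (c * G / (X * Y * X)) := by
  have hX0 : 0 < X := by linarith
  have hY0 : 0 < Y := by linarith
  by_cases hne : ∃ p r q : ℤ, X * Y ≤ q ∧ q ≤ G * (X * Y) ∧
      (pointSet a₁ b₁ a₂ b₂ 0 0 c X Y p r q ∩ closedBall x ρ).Nonempty
  · obtain ⟨p₁, r₁, q₁, hq₁, hq₁', t₁, h₁, ht₁⟩ := hne
    have hq₁0 : (0 : ℝ) < q₁ := lt_of_lt_of_le (by positivity) hq₁
    refine ⟨(p₁ / q₁ - b₁) / a₁, fun p r q hq hq' t ⟨h, ht⟩ => ?_⟩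
    have hq0 : (0 : ℝ) < q := lt_of_lt_of_le (by positivity) hq
    obtain ⟨hA, hB, hs, hF⟩ := lineForm_through_points ha₁ ha₂ hG hY hYX hc hcT hT hρ
      (by exact_mod_cast hq₁0.le) hq₁' (by exact_mod_cast hq0.le) hq' ht₁ ht h₁ h
    -- Equality of the first coordinates is enough, because the interval of a point is centred using
    -- that coordinate alone.
    have h0 : q₁ * p - p₁ * q = 0 := by
      by_contra h0
      exact hline _ _ _ hA hB hs (fun h => h0 h.2) hF
    have h0' : (q₁ * p - p₁ * q : ℝ) = 0 := by exact_mod_cast h0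
    have hz : ((p + 0) / q - b₁) / a₁ = (p₁ / q₁ - b₁) / a₁ := by
      congr 2
      rw [add_zero, div_eq_div_iff hq0.ne' hq₁0.ne']
      linarith
    rw [← hz]
    exact pointSet_subset_closedBall ha₁' hX0 hY0 hq h
  · refine ⟨0, fun p r q hq hq' t ht => ?_⟩
    exact absurd ⟨p, r, q, hq, hq', t, ht⟩ hne

/-- Nearby shifted rational points of comparable height coincide if no rational point is close. -/
theorem exists_closedBall_of_pointSet_shift {a₁ b₁ a₂ b₂ γ δ c G T X Y ρ x : ℝ}
    (ha₁ : |a₁| ≤ G) (ha₁' : 1 ≤ G * |a₁|) (ha₂ : |a₂| ≤ G) (hG : 4 ≤ G) (hY : 1 ≤ Y) (hYX : Y ≤ X)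
    (hc : 0 < c) (hcT : c ≤ T) (hT : 6 * G ^ 2 * T < 1) (hρ : ρ * (X * Y * X) ≤ T)
    (hρ0 : 0 ≤ ρ)
    (hpoint : ∀ p r q : ℤ, 0 < q → q ≤ G * (X * Y) →
      ¬ closedBall x ρ ⊆ pointSet a₁ b₁ a₂ b₂ 0 0 (6 * G ^ 2 * T) X Y p r q) :
    ∃ z, ∀ p r q : ℤ, X * Y ≤ q → q ≤ G * (X * Y) →
      pointSet a₁ b₁ a₂ b₂ γ δ c X Y p r q ∩ closedBall x ρ ⊆
        closedBall z (c * G / (X * Y * X)) := by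
  have hX0 : 0 < X := by linarith
  have hY0 : 0 < Y := by linarith
  have hT0 : 0 < T := by linarith
  have hρY : ρ * (X * Y * Y) ≤ T := le_trans (by gcongr) hρ
  by_cases hne : ∃ p r q : ℤ, X * Y ≤ q ∧ q ≤ G * (X * Y) ∧
      (pointSet a₁ b₁ a₂ b₂ γ δ c X Y p r q ∩ closedBall x ρ).Nonempty
  · obtain ⟨p₁, r₁, q₁, hq₁, hq₁', t₁, h₁, ht₁⟩ := hne
    have hq₁0 : (0 : ℝ) < q₁ := lt_of_lt_of_le (by positivity) hq₁
    -- Subtracting two shifted points cancels the shift.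
    have hsub : ∀ (p r q p' r' q' : ℤ) (t s : ℝ), (0 : ℝ) < q → q ≤ G * (X * Y) → (0 : ℝ) < q' →
        q' ≤ G * (X * Y) → t ∈ closedBall x ρ → s ∈ closedBall x ρ →
        t ∈ pointSet a₁ b₁ a₂ b₂ γ δ c X Y p r q → s ∈ pointSet a₁ b₁ a₂ b₂ γ δ c X Y p' r' q' →
        closedBall x ρ ⊆
          pointSet a₁ b₁ a₂ b₂ 0 0 (6 * G ^ 2 * T) X Y (p - p') (r - r') (q - q') := by
      intro p r q p' r' q' t s hq hqG hq' hqG' ht hs h h' w hw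
      have hq0 : 0 ≤ q := by exact_mod_cast hq.le
      have hq0' : 0 ≤ q' := by exact_mod_cast hq'.le
      constructor
      · have h1 := abs_le_of_mem_closedBall ha₁ (by linarith) hX0 (by positivity) hcT hρ hq0 hqG
          ht hw h.1
        have h2 := abs_le_of_mem_closedBall ha₁ (by linarith) hX0 (by positivity) hcT hρ hq0' hqG'
          hs hw h'.1
        have h3 := (abs_sub _ _).trans (add_le_add h1 h2)
        refine le_trans (le_of_eq ?_) (h3.trans (le_of_eq ?_))
        · congr 1; push_cast; ring
        · ring
      · have h1 := abs_le_of_mem_closedBall ha₂ (by linarith) hY0 (by positivity) hcT hρY hq0 hqG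
          ht hw h.2
        have h2 := abs_le_of_mem_closedBall ha₂ (by linarith) hY0 (by positivity) hcT hρY hq0' hqG'
          hs hw h'.2
        have h3 := (abs_sub _ _).trans (add_le_add h1 h2)
        refine le_trans (le_of_eq ?_) (h3.trans (le_of_eq ?_))
        · congr 1; push_cast; ring
        · ring
    refine ⟨((p₁ + γ) / q₁ - b₁) / a₁, fun p r q hq hq' t ⟨h, ht⟩ => ?_⟩
    have hq0 : (0 : ℝ) < q := lt_of_lt_of_le (by positivity) hq
    have hqq : q = q₁ := by
      rcases lt_trichotomy q q₁ with hlt | heq | hlt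
      · refine absurd (hsub p₁ r₁ q₁ p r q t₁ t hq₁0 hq₁' hq0 hq' ht₁ ht h₁ h)
          (hpoint _ _ _ (by omega) ?_)
        push_cast
        linarith
      · exact heq
      · refine absurd (hsub p r q p₁ r₁ q₁ t t₁ hq0 hq' hq₁0 hq₁' ht ht₁ h h₁)
          (hpoint _ _ _ (by omega) ?_)
        push_cast
        linarith
    subst hqq
    -- With equal denominators the difference of the numerators is an integer of absolute value less
    -- than `1`.
    have hpp : p = p₁ := by
      have h1 := (hsub p r q p₁ r₁ q t t₁ hq0 hq' hq₁0 hq₁' ht ht₁ h h₁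
        (mem_closedBall_self hρ0)).1
      have h2 : 6 * G ^ 2 * T / X < 1 := by
        rw [div_lt_one hX0]
        linarith
      have h3 : |((p - p₁ : ℤ) : ℝ)| < 1 := by
        refine lt_of_le_of_lt ?_ h2
        rw [sub_self, Int.cast_zero, zero_mul, sub_zero, zero_sub, abs_neg] at h1
        exact h1
      have h4 : |p - p₁| < 1 := by exact_mod_cast h3
      have := Int.abs_lt_one_iff.1 h4
      omega
    subst hpp
    exact pointSet_subset_closedBall ha₁' hX0 hY0 hq h
  · refine ⟨0, fun p r q hq hq' t ht => ?_⟩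
    exact absurd ⟨p, r, q, hq, hq', t, ht⟩ hne

/-- The common point of two dangerous lines is close to the given line. -/
theorem exists_closedBall_of_lineForm {a₁ b₁ a₂ b₂ c G R S W X Y ρ x : ℝ}
    (ha₁' : 1 ≤ G * |a₁|) (hG : 4 ≤ G) (hY : 1 ≤ Y) (hYX : Y ≤ X)
    (hR : 0 < R) (hS : 0 < S) (hW : c + 2 * ρ * S * (X * Y) ≤ W) (hWY : 2 * W < Y) (hρ0 : 0 ≤ ρ)
    (hpoint : ∀ p r q : ℤ, 0 < q → q ≤ 2 * G * S * Y →
      ¬ closedBall x ρ ⊆ pointSet a₁ b₁ a₂ b₂ 0 0 (2 * W) X Y p r q) :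
    ∃ z, ∀ A B C : ℤ, |(A : ℝ)| ≤ X → |(B : ℝ)| ≤ Y → S / R < |a₁ * A + a₂ * B| →
      |a₁ * A + a₂ * B| ≤ S →
      {t | |lineForm a₁ b₁ a₂ b₂ A B C t| ≤ c / (X * Y)} ∩ closedBall x ρ ⊆
        closedBall z (c * R / (X * Y * S)) := by
  have hX0 : 0 < X := by linarith
  have hY0 : 0 < Y := by linarith
  by_cases hne : ∃ A B C : ℤ, |(A : ℝ)| ≤ X ∧ |(B : ℝ)| ≤ Y ∧ S / R < |a₁ * A + a₂ * B| ∧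
      |a₁ * A + a₂ * B| ≤ S ∧
      ({t | |lineForm a₁ b₁ a₂ b₂ A B C t| ≤ c / (X * Y)} ∩ closedBall x ρ).Nonempty
  · obtain ⟨A₁, B₁, C₁, hA₁, hB₁, hs₁, hS₁, t₁, h₁, ht₁⟩ := hne
    have hF : ∀ (A B C : ℤ) (t : ℝ), |a₁ * A + a₂ * B| ≤ S →
        |lineForm a₁ b₁ a₂ b₂ A B C t| ≤ c / (X * Y) → t ∈ closedBall x ρ →
        ∀ s ∈ closedBall x ρ, |lineForm a₁ b₁ a₂ b₂ A B C s| ≤ W / (X * Y) := by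
      intro A B C t hS' h ht s hs
      have hst : |s - t| ≤ 2 * ρ := by
        rw [mem_closedBall, Real.dist_eq] at hs ht
        have := abs_sub_le s x t
        rw [abs_sub_comm x t] at this
        linarith
      have e : lineForm a₁ b₁ a₂ b₂ A B C s =
          lineForm a₁ b₁ a₂ b₂ A B C t + (a₁ * A + a₂ * B) * (s - t) := by
        simp only [lineForm]; ring
      rw [e]
      have h1 : |(a₁ * A + a₂ * B) * (s - t)| ≤ S * (2 * ρ) := by
        rw [abs_mul]; gcongr
      refine (abs_add_le _ _).trans ((add_le_add h h1).trans ?_)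
      rw [le_div_iff₀ (by positivity), add_mul, div_mul_cancel₀ _ (by positivity)]
      linarith
    have hσ₁ : a₁ * A₁ + a₂ * B₁ ≠ 0 := abs_pos.1 (lt_of_le_of_lt (by positivity) hs₁)
    refine ⟨-(A₁ * b₁ + B₁ * b₂ + C₁) / (a₁ * A₁ + a₂ * B₁), fun A B C hA hB hs hS' t ⟨h, ht⟩ => ?_⟩
    have hpos : 0 < |a₁ * A + a₂ * B| := lt_of_le_of_lt (by positivity) hs
    -- The errors of the cross product of two lines are combinations of the two forms, with the
    -- coefficients of the other line as multipliers.
    have hsub : ∀ A B C A' B' C' : ℤ, |(A : ℝ)| ≤ X → |(B : ℝ)| ≤ Y → |(A' : ℝ)| ≤ X →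
        |(B' : ℝ)| ≤ Y → (∀ s ∈ closedBall x ρ, |lineForm a₁ b₁ a₂ b₂ A B C s| ≤ W / (X * Y)) →
        (∀ s ∈ closedBall x ρ, |lineForm a₁ b₁ a₂ b₂ A' B' C' s| ≤ W / (X * Y)) →
        closedBall x ρ ⊆ pointSet a₁ b₁ a₂ b₂ 0 0 (2 * W) X Y
          (B * C' - C * B') (C * A' - A * C') (A * B' - B * A') := by
      intro A B C A' B' C' hA hB hA' hB' hF hF' s hs
      constructor
      · refine le_trans (le_of_eq ?_)
          ((abs_mul_sub_mul_le hB' (hF s hs) hB (hF' s hs)).trans (le_of_eq ?_))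
        · congr 1; simp only [lineForm]; push_cast; ring
        · field_simp; ring
      · refine le_trans (le_of_eq ?_)
          ((abs_mul_sub_mul_le hA (hF' s hs) hA' (hF s hs)).trans (le_of_eq ?_))
        · congr 1; simp only [lineForm]; push_cast; ring
        · field_simp; ring
    have hF₁ := hF A₁ B₁ C₁ t₁ hS₁ h₁ ht₁
    have hF₂ := hF A B C t hS' h ht
    -- Up to the factor `a₁`, the determinant is a combination of the two slopes, so small slopes
    -- give a small denominator.
    have hq : |((A₁ * B - B₁ * A : ℤ) : ℝ)| ≤ 2 * G * S * Y := by
      have h1 := abs_mul_sub_mul_le hS₁ hB hS' hB₁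
      have e : (a₁ * A₁ + a₂ * B₁) * B - (a₁ * A + a₂ * B) * B₁ =
          a₁ * ((A₁ * B - B₁ * A : ℤ) : ℝ) := by push_cast; ring
      rw [e, abs_mul] at h1
      calc _ ≤ G * |a₁| * |((A₁ * B - B₁ * A : ℤ) : ℝ)| := le_mul_of_one_le_left (abs_nonneg _) ha₁'
        _ = G * (|a₁| * |((A₁ * B - B₁ * A : ℤ) : ℝ)|) := by ring
        _ ≤ G * (S * Y + S * Y) := by gcongr
        _ = _ := by ring
    have hq0 : A₁ * B - B₁ * A = 0 := by
      by_contra hne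
      rcases lt_or_gt_of_ne hne with hlt | hlt
      · refine hpoint _ _ (A * B₁ - B * A₁) (by linarith) ?_
          (hsub A B C A₁ B₁ C₁ hA hB hA₁ hB₁ hF₂ hF₁)
        have := (neg_le_abs _).trans hq
        push_cast at this ⊢
        linarith
      · exact hpoint _ _ _ hlt ((le_abs_self _).trans hq)
          (hsub A₁ B₁ C₁ A B C hA₁ hB₁ hA hB hF₁ hF₂)
    -- Once the denominator vanishes, the other two minors are integers below `1`; the lines are
    -- then proportional and have the same zero.
    have hlast := hsub A₁ B₁ C₁ A B C hA₁ hB₁ hA hB hF₁ hF₂ (mem_closedBall_self hρ0)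
    rw [hq0] at hlast
    have hint : ∀ (n : ℤ) (w Z : ℝ), 0 < Z → 2 * W < Z →
        |((0 : ℤ) : ℝ) * w - 0 - n| ≤ 2 * W / Z → n = 0 := by
      intro n w Z hZ hWZ hn
      rw [Int.cast_zero, zero_mul, sub_zero, zero_sub, abs_neg] at hn
      have h1 : |(n : ℝ)| < 1 := lt_of_le_of_lt hn ((div_lt_one hZ).2 hWZ)
      exact Int.abs_lt_one_iff.1 (by exact_mod_cast h1)
    have hp0 := hint _ _ X hX0 (by linarith) hlast.1
    have hr0 := hint _ _ Y hY0 hWY hlast.2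
    have hq0' : (A₁ * B - B₁ * A : ℝ) = 0 := by exact_mod_cast hq0
    have hp0' : (B₁ * C - C₁ * B : ℝ) = 0 := by exact_mod_cast hp0
    have hr0' : (C₁ * A - A₁ * C : ℝ) = 0 := by exact_mod_cast hr0
    have hσ : a₁ * A + a₂ * B ≠ 0 := abs_pos.1 hpos
    have hz : -(A * b₁ + B * b₂ + C) / (a₁ * A + a₂ * B) =
        -(A₁ * b₁ + B₁ * b₂ + C₁) / (a₁ * A₁ + a₂ * B₁) := by
      rw [div_eq_div_iff hσ hσ₁]
      linear_combination (a₂ * b₁ - a₁ * b₂) * hq0' - a₂ * hp0' + a₁ * hr0'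
    rw [← hz]
    exact lineForm_subset_closedBall hR hS (by positivity) hs h
  · refine ⟨0, fun A B C hA hB hs hS' t ht => ?_⟩
    exact absurd ⟨A, B, C, hA, hB, hs, hS', t, ht⟩ hne

/-! ### Stages and total weights of the classes -/

theorem tsum_subtype_ofReal_le_geometric {K : Type} {s : Set K} {w : K → ℝ} {g : K → ℕ} {M q : ℝ}
    (hM : 0 ≤ M) (hq0 : 0 ≤ q) (hq1 : q < 1) (hg : Set.InjOn g s) (hw : ∀ k ∈ s, w k ≤ M * q ^ g k) :
    ∑' k : s, ENNReal.ofReal (w k) ≤ ENNReal.ofReal (M * (1 - q)⁻¹) := by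
  calc ∑' k : s, ENNReal.ofReal (w k) ≤ ∑' k : s, ENNReal.ofReal (M * q ^ g k) :=
        ENNReal.tsum_le_tsum fun k => ENNReal.ofReal_le_ofReal (hw k k.2)
    _ ≤ ∑' n, ENNReal.ofReal (M * q ^ n) :=
        ENNReal.tsum_comp_le_tsum_of_injective (hg.injective) fun n => ENNReal.ofReal (M * q ^ n)
    _ = ENNReal.ofReal (M * (1 - q)⁻¹) := by
        rw [← ENNReal.ofReal_tsum_of_nonneg (fun n => by positivity)
          ((summable_geometric_of_lt_one hq0 hq1).mul_left M), tsum_mul_left,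
          tsum_geometric_of_lt_one hq0 hq1]

theorem tsum_subtype_ofReal_le_of_subsingleton {K : Type} {s : Set K} {w : K → ℝ} {M : ℝ}
    (hM : 0 ≤ M) (hs : s.Subsingleton) (hw : ∀ k ∈ s, w k ≤ M) :
    ∑' k : s, ENNReal.ofReal (w k) ≤ ENNReal.ofReal M := by
  have := tsum_subtype_ofReal_le_geometric (w := w) (g := fun _ => 0) hM le_rfl zero_lt_one
    (fun a ha b hb _ => hs ha hb) (fun k hk => by simpa using hw k hk)
  simpa using this

theorem tsum_subtype_ofReal_le_geometric_prod {s : Set (ℕ × ℕ)} {w : ℕ × ℕ → ℝ} {M q₁ q₂ : ℝ}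
    (hM : 0 ≤ M) (hq₁ : 0 ≤ q₁) (hq₁' : q₁ < 1) (hq₂ : 0 ≤ q₂) (hq₂' : q₂ < 1)
    (hw : ∀ k ∈ s, w k ≤ M * (q₁ ^ k.1 * q₂ ^ k.2)) :
    ∑' k : s, ENNReal.ofReal (w k) ≤ ENNReal.ofReal (M * ((1 - q₁)⁻¹ * (1 - q₂)⁻¹)) := by
  calc ∑' k : s, ENNReal.ofReal (w k) ≤ ∑' k : s, ENNReal.ofReal (M * (q₁ ^ k.1.1 * q₂ ^ k.1.2)) :=
        ENNReal.tsum_le_tsum fun k => ENNReal.ofReal_le_ofReal (hw k k.2)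
    _ ≤ ∑' k : ℕ × ℕ, ENNReal.ofReal (M * (q₁ ^ k.1 * q₂ ^ k.2)) :=
        ENNReal.tsum_comp_le_tsum_of_injective Subtype.val_injective
          fun k : ℕ × ℕ => ENNReal.ofReal (M * (q₁ ^ k.1 * q₂ ^ k.2))
    _ = ENNReal.ofReal (M * ((1 - q₁)⁻¹ * (1 - q₂)⁻¹)) := by
        have h1 := summable_geometric_of_lt_one hq₁ hq₁'
        have h2 := summable_geometric_of_lt_one hq₂ hq₂'
        have h3 := h1.mul_of_nonneg h2 (fun n => by positivity) (fun n => by positivity)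
        rw [← ENNReal.ofReal_tsum_of_nonneg (fun n => by positivity) (h3.mul_left M),
          tsum_mul_left, ← tsum_geometric_of_lt_one hq₁ hq₁', ← tsum_geometric_of_lt_one hq₂ hq₂',
          h1.tsum_mul_tsum h2 h3]

theorem exists_mul_pow_le {r ρ₀ : ℝ} (hr0 : 0 < r) (hr1 : r < 1) {x : ℝ} (hx : 0 < x) :
    ∃ n : ℕ, ρ₀ * r ^ n ≤ x := by
  have h := (tendsto_pow_atTop_nhds_zero_of_lt_one hr0.le hr1).const_mul ρ₀
  rw [mul_zero] at h
  exact ((h.eventually (gt_mem_nhds hx)).exists).imp fun n hn => hn.le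

open Classical in
/-- The least `n` such that `ρ₀ * r ^ n ≤ x`. -/
noncomputable def stageOf (r ρ₀ x : ℝ) : ℕ :=
  if h : ∃ n : ℕ, ρ₀ * r ^ n ≤ x then Nat.find h else 0

theorem mul_pow_stageOf_le {r ρ₀ : ℝ} (hr0 : 0 < r) (hr1 : r < 1) {x : ℝ} (hx : 0 < x) :
    ρ₀ * r ^ stageOf r ρ₀ x ≤ x := by
  classical
  have h := exists_mul_pow_le (ρ₀ := ρ₀) hr0 hr1 hx
  rw [stageOf, dif_pos h]
  exact Nat.find_spec h

theorem lt_of_stageOf_eq_succ {r ρ₀ x : ℝ} {n : ℕ} (h : stageOf r ρ₀ x = n + 1) :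
    x < ρ₀ * r ^ n := by
  classical
  by_cases h' : ∃ n : ℕ, ρ₀ * r ^ n ≤ x
  · rw [stageOf, dif_pos h'] at h
    exact not_le.1 (Nat.find_min h' (by omega : n < Nat.find h'))
  · exact absurd h (by simp [stageOf, h'])

/-- Values with the same positive stage differ by a factor less than `r⁻¹`. -/
theorem mul_lt_of_stageOf_eq {r ρ₀ : ℝ} (hr0 : 0 < r) (hr1 : r < 1) {x y : ℝ}
    (hy : 0 < y) {n : ℕ} (hn : n ≠ 0) (hxn : stageOf r ρ₀ x = n)
    (hyn : stageOf r ρ₀ y = n) : r * x < y := by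
  obtain ⟨n, rfl⟩ := Nat.exists_eq_succ_of_ne_zero hn
  have h1 := lt_of_stageOf_eq_succ hxn
  have h2 := mul_pow_stageOf_le (ρ₀ := ρ₀) hr0 hr1 hy
  rw [hyn, pow_succ] at h2
  nlinarith

theorem rpow_le_of_stageOf_eq {r ρ₀ η C x w : ℝ} (hr0 : 0 < r) (hρ₀ : 0 < ρ₀) (hη : 0 < η)
    (hC : 0 ≤ C) (hw0 : 0 ≤ w) {n : ℕ} (hn : n ≠ 0) (hxn : stageOf r ρ₀ x = n)
    (hw : w ≤ C * x) : w ^ η ≤ (C / r) ^ η * (ρ₀ * r ^ n) ^ η := by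
  obtain ⟨n, rfl⟩ := Nat.exists_eq_succ_of_ne_zero hn
  have h1 := lt_of_stageOf_eq_succ hxn
  rw [← Real.mul_rpow (by positivity) (by positivity)]
  apply Real.rpow_le_rpow hw0 _ hη.le
  calc w ≤ C * x := hw
    _ ≤ C * (ρ₀ * r ^ n) := by gcongr
    _ = _ := by rw [Nat.succ_eq_add_one, pow_succ]; field_simp

theorem tendsto_const_mul_rpow {s : ℝ} (hs : 0 < s) (C : ℝ) :
    Tendsto (fun m : ℝ => C * m ^ s) (𝓝[>] 0) (𝓝 0) := by
  have h := (Real.continuousAt_rpow_const 0 s (Or.inr hs.le)).tendsto.const_mul C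
  rw [Real.zero_rpow hs.ne', mul_zero] at h
  exact h.mono_left nhdsWithin_le_nhds

/-- The weights of the classes of rational points. -/
theorem eventually_tsum_point_le {r ρ₀ η T κ : ℝ} (hr0 : 0 < r) (hr1 : r < 1) (hρ₀ : 0 < ρ₀)
    (hη : 0 < η) (hT : 0 < T) (hκ : 0 < κ) {Z : ℕ → ℝ} (hZ0 : ∀ h, (r⁻¹) ^ h ≤ Z h)
    (hZ : ∀ h h', h < h' → Z h ≤ r * Z h') :
    ∀ᶠ m : ℝ in 𝓝[>] 0, ∀ n, ∑' h : {h | stageOf r ρ₀ (T / Z h) = n},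
      ENNReal.ofReal ((m / Z h) ^ η) ≤ ENNReal.ofReal (κ * (ρ₀ * r ^ n) ^ η) := by
  have hZpos : ∀ h, 0 < Z h := fun h => lt_of_lt_of_le (by positivity) (hZ0 h)
  have hq1 : r ^ η < 1 := Real.rpow_lt_one hr0.le hr1 hη
  have h1 := (tendsto_const_mul_rpow hη ((1 - r ^ η)⁻¹)).eventually_le_const
    (by positivity : 0 < κ * ρ₀ ^ η)
  have h2 := (tendsto_const_mul_rpow hη ((T * r)⁻¹ ^ η)).eventually_le_const hκ
  filter_upwards [h1, h2, self_mem_nhdsWithin] with m h1 h2 hm n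
  have hm : 0 < m := hm
  -- Stage `0` may hold many classes, so the whole geometric series is summed and made small by `m`.
  -- A positive stage holds at most one class, since `Z` grows by a factor at least `r⁻¹`.
  by_cases hn : n = 0
  · subst hn
    refine (tsum_subtype_ofReal_le_geometric (w := fun h => (m / Z h) ^ η) (g := fun h => h)
      (M := m ^ η) (q := r ^ η) (by positivity) (by positivity) hq1
      (fun _ _ _ _ h => h) fun h _ => ?_).trans (ENNReal.ofReal_le_ofReal ?_)
    · rw [← Real.rpow_natCast (r ^ η), ← Real.rpow_mul hr0.le, mul_comm η, Real.rpow_mul hr0.le,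
        Real.rpow_natCast, ← Real.mul_rpow hm.le (by positivity)]
      have := hZpos h
      apply Real.rpow_le_rpow (by positivity) _ hη.le
      rw [div_eq_mul_inv]
      gcongr
      rw [inv_le_comm₀ this (by positivity), ← inv_pow]
      exact hZ0 h
    · rw [pow_zero, mul_one]
      linarith
  · refine (tsum_subtype_ofReal_le_of_subsingleton (w := fun h => (m / Z h) ^ η)
      (M := κ * (ρ₀ * r ^ n) ^ η) (by positivity) ?_ ?_)
    · have key : ∀ h h', stageOf r ρ₀ (T / Z h) = n → stageOf r ρ₀ (T / Z h') = n → ¬ h < h' := by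
        intro h h' hh hh' hlt
        have := hZpos h
        have := hZpos h'
        have h3 := mul_lt_of_stageOf_eq hr0 hr1 (by positivity) hn hh hh'
        have h4 := hZ h h' hlt
        rw [mul_div_assoc', div_lt_div_iff₀ (by positivity) (by positivity)] at h3
        nlinarith
      intro h hh h' hh'
      have h3 := key h h' hh hh'
      have h4 := key h' h hh' hh
      omega
    · intro h hh
      have := hZpos h
      refine (rpow_le_of_stageOf_eq (C := m / T) hr0 hρ₀ hη (by positivity) (by positivity) hn hh
        (le_of_eq (by field_simp))).trans ?_
      gcongr
      refine le_trans (le_of_eq ?_) h2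
      rw [← Real.mul_rpow (by positivity) hm.le]
      congr 1
      field_simp

/-- The weights of the classes of lines. The numbers `H k` and `S k` bound the height and
the slope; `v k` measures how rare the class is. -/
theorem eventually_tsum_line_le {r ρ₀ η κ κ' ε i j G : ℝ} (hr0 : 0 < r) (hr1 : r < 1) (hρ₀ : 0 < ρ₀)
    (hη : 0 < η) (hκ : 0 < κ) (hκ' : 0 < κ') (hε : 0 < ε) (hj : 0 < j) (hji : j ≤ i)
    (hij : i + j = 1) (hG : 1 ≤ G) :
    ∀ᶠ c : ℝ in 𝓝[>] 0, ∀ (H S v : ℕ × ℕ → ℝ),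
      (∀ k, H k = (r⁻¹) ^ k.1) → (∀ k, S k = 4 * G ^ 2 * c * H k ^ i * r ^ k.2) →
      (∀ k, v k = min ((r⁻¹) ^ k.2 / (8 * G ^ 3 * c)) (H k)) →
      ∀ n, ∑' k : {k | κ' * H k ^ ε ≤ H k * S k ∧
          stageOf r ρ₀ (c * v k ^ j / 8 / (H k * S k)) = n},
        ENNReal.ofReal ((c * r⁻¹ / (H k * S k)) ^ η) ≤ ENNReal.ofReal (κ * (ρ₀ * r ^ n) ^ η) := by
  have hR1 : 1 ≤ r⁻¹ := (one_le_inv₀ hr0).2 hr1.le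
  have hi : 0 < i := hj.trans_le hji
  have hlt1 : ∀ s : ℝ, 0 < s → r ^ s < 1 := fun s hs => Real.rpow_lt_one hr0.le hr1 hs
  have hjη : 0 < j * η := by positivity
  have hεη : 0 < ε * η := by positivity
  -- `t1` serves stage `0`; `t2` and `t3` serve the positive stages, according to which term of the
  -- minimum gives `v`.
  have t1 := (tendsto_const_mul_rpow (add_pos hη (by linarith : 0 < ε * η / 4))
    ((r⁻¹ / κ') ^ η * (4 * G ^ 2 / κ') ^ (ε * η / 4) *
      ((1 - r ^ (ε * η / 2))⁻¹ * (1 - r ^ (ε * η / 4))⁻¹))).eventually_le_const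
    (by positivity : 0 < κ * ρ₀ ^ η)
  have t2 := (tendsto_const_mul_rpow hjη ((8 * r⁻¹ / r) ^ η * (8 * G ^ 3) ^ (j * η) *
    (1 - r ^ (j * η))⁻¹)).eventually_le_const (half_pos hκ)
  have t3 := (tendsto_const_mul_rpow (by linarith : 0 < j * η / 4)
    ((8 * r⁻¹ / r) ^ η * (4 * G ^ 2 / κ') ^ (j * η / 4) *
    (1 - r ^ (j * η / 2))⁻¹)).eventually_le_const (half_pos hκ)
  filter_upwards [t1, t2, t3, self_mem_nhdsWithin] with c t1 t2 t3 hc H S v hH hS hv n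
  have hc : 0 < c := hc
  have hG0 : 0 < G := by linarith
  have hH1 : ∀ k, 1 ≤ H k := fun k => by rw [hH]; exact one_le_pow₀ hR1
  have hH0 : ∀ k, 0 < H k := fun k => zero_lt_one.trans_le (hH1 k)
  have hS0 : ∀ k, 0 < S k := fun k => by
    have := hH0 k
    rw [hS]; positivity
  have hv0 : ∀ k, 0 < v k := fun k => by
    have := hH0 k
    rw [hv]; positivity
  have hrpow : ∀ (s : ℝ) (m : ℕ), (r ^ m) ^ s = (r ^ s) ^ m := fun s m => by
    rw [← Real.rpow_natCast, ← Real.rpow_natCast, ← Real.rpow_mul hr0.le, ← Real.rpow_mul hr0.le,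
      mul_comm]
  have hrH : ∀ k, r ^ k.1 * H k = 1 := fun k => by
    rw [hH, inv_pow]; exact mul_inv_cancel₀ (by positivity)
  -- classes that are not empty have large height
  have hlarge : ∀ k, κ' * H k ^ ε ≤ H k * S k → (r ^ k.1) ^ 2 ≤ 4 * G ^ 2 * c / κ' * r ^ k.2 := by
    intro k hk
    have h0 := hH0 k
    have h1 : κ' * 1 ≤ κ' * H k ^ ε := by
      gcongr
      exact Real.one_le_rpow (hH1 k) hε.le
    have h2 : H k ^ i ≤ H k ^ (1 : ℝ) :=
      Real.rpow_le_rpow_of_exponent_le (hH1 k) (by linarith)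
    rw [Real.rpow_one] at h2
    have h3 : H k * S k ≤ H k * (4 * G ^ 2 * c * H k * r ^ k.2) := by
      rw [hS]; gcongr
    have h4 : κ' ≤ H k * (4 * G ^ 2 * c * H k * r ^ k.2) := by linarith
    rw [div_mul_eq_mul_div, le_div_iff₀ hκ']
    calc (r ^ k.1) ^ 2 * κ' ≤ (r ^ k.1) ^ 2 * (H k * (4 * G ^ 2 * c * H k * r ^ k.2)) := by gcongr
      _ = (r ^ k.1 * H k) ^ 2 * (4 * G ^ 2 * c * r ^ k.2) := by ring
      _ = _ := by rw [hrH]; ring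
  by_cases hn : n = 0
  -- At stage `0` the factor `H ^ (-ε * η)` is split in two: one half decays with the height, the
  -- other is turned by `hlarge` into decay in the slope index and a power of `c`. The double series
  -- converges because `ε` is positive.
  · refine (tsum_subtype_ofReal_le_geometric_prod (w := fun k => (c * r⁻¹ / (H k * S k)) ^ η)
      (M := (r⁻¹ / κ') ^ η * (4 * G ^ 2 / κ') ^ (ε * η / 4) * c ^ (η + ε * η / 4))
      (q₁ := r ^ (ε * η / 2)) (q₂ := r ^ (ε * η / 4)) (by positivity) (by positivity)
      (hlt1 _ (by linarith)) (by positivity) (hlt1 _ (by linarith)) ?_).trans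
      (ENNReal.ofReal_le_ofReal ?_)
    · rintro k ⟨hk, -⟩
      have h0 := hH0 k
      have h1 : c * r⁻¹ / (H k * S k) ≤ c * (r⁻¹ / κ') * (r ^ k.1) ^ ε := by
        rw [div_le_iff₀ (mul_pos (hH0 k) (hS0 k))]
        have h2 : (r ^ k.1) ^ ε * H k ^ ε = 1 := by
          rw [← Real.mul_rpow (by positivity) h0.le, hrH, Real.one_rpow]
        calc c * r⁻¹ = c * (r⁻¹ / κ') * κ' * ((r ^ k.1) ^ ε * H k ^ ε) := by
              rw [h2]; field_simp
          _ = c * (r⁻¹ / κ') * (r ^ k.1) ^ ε * (κ' * H k ^ ε) := by ring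
          _ ≤ _ := by gcongr
      have h3 := Real.rpow_le_rpow (div_pos (by positivity) (mul_pos (hH0 k) (hS0 k))).le h1 hη.le
      refine h3.trans ?_
      rw [Real.mul_rpow (by positivity) (by positivity), Real.mul_rpow hc.le (by positivity),
        ← Real.rpow_mul (by positivity)]
      have h4 : (r ^ k.1) ^ (ε * η) = (r ^ (ε * η / 2)) ^ k.1 * ((r ^ k.1) ^ 2) ^ (ε * η / 4) := by
        rw [← hrpow, ← Real.rpow_natCast _ 2, ← Real.rpow_mul (by positivity),
          ← Real.rpow_add (by positivity)]
        congr 1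
        push_cast
        ring
      have h5 : ((r ^ k.1) ^ 2) ^ (ε * η / 4) ≤
          (4 * G ^ 2 / κ') ^ (ε * η / 4) * c ^ (ε * η / 4) * (r ^ (ε * η / 4)) ^ k.2 := by
        refine (Real.rpow_le_rpow (by positivity) (hlarge k hk) (by positivity)).trans
          (le_of_eq ?_)
        rw [Real.mul_rpow (by positivity) (by positivity), hrpow, ← Real.mul_rpow (by positivity)
          hc.le]
        congr 2
        ring
      rw [h4, Real.rpow_add hc]
      calc c ^ η * (r⁻¹ / κ') ^ η * ((r ^ (ε * η / 2)) ^ k.1 * ((r ^ k.1) ^ 2) ^ (ε * η / 4))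
          ≤ c ^ η * (r⁻¹ / κ') ^ η * ((r ^ (ε * η / 2)) ^ k.1 * ((4 * G ^ 2 / κ') ^ (ε * η / 4) *
            c ^ (ε * η / 4) * (r ^ (ε * η / 4)) ^ k.2)) := by gcongr
        _ = _ := by ring
    · subst hn
      rw [pow_zero, mul_one]
      linarith
  have hρpos : ∀ k, 0 < c * v k ^ j / 8 / (H k * S k) := fun k => by
    have := hH0 k
    have := hS0 k
    have := hv0 k
    positivity
  -- At a fixed height, each step in the slope index divides `S` by `r⁻¹` and does not decrease `v`,
  -- so the target radius grows by at least `r⁻¹` and the stage changes.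
  have inj₂ : ∀ k k' : ℕ × ℕ, stageOf r ρ₀ (c * v k ^ j / 8 / (H k * S k)) = n →
      stageOf r ρ₀ (c * v k' ^ j / 8 / (H k' * S k')) = n → k.1 = k'.1 → ¬ k.2 < k'.2 := by
    intro k k' hk hk' he hlt
    have hHe : H k' = H k := by rw [hH, hH, he]
    have h0 := hH0 k
    have h1 := mul_lt_of_stageOf_eq hr0 hr1 (hρpos k) hn hk' hk
    have hSS : S k' ≤ r * S k := by
      rw [hS, hS, hHe]
      have : r ^ k'.2 ≤ r ^ (k.2 + 1) := pow_le_pow_of_le_one hr0.le hr1.le hlt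
      calc _ ≤ 4 * G ^ 2 * c * H k ^ i * r ^ (k.2 + 1) := by gcongr
        _ = _ := by ring
    have hvv : v k ≤ v k' := by
      rw [hv, hv, hHe]
      gcongr
    have hvj : v k ^ j ≤ v k' ^ j := Real.rpow_le_rpow (hv0 k).le hvv hj.le
    have := hS0 k
    have := hS0 k'
    rw [hHe, mul_div_assoc', div_lt_div_iff₀ (by positivity) (by positivity)] at h1
    have h2 : c * v k ^ j / 8 * (H k * S k') ≤ c * v k' ^ j / 8 * (H k * (r * S k)) := by
      have := hv0 k
      have := hv0 k'
      gcongr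
    linarith
  -- If the height grows by `t`, then `S` grows by `t ^ i` and `v ^ j` by at most `t ^ j ≤ t ^ i`.
  -- The target radius therefore shrinks by at least `t`.
  have inj₁ : ∀ k k' : ℕ × ℕ, stageOf r ρ₀ (c * v k ^ j / 8 / (H k * S k)) = n →
      stageOf r ρ₀ (c * v k' ^ j / 8 / (H k' * S k')) = n → k.2 = k'.2 → ¬ k.1 < k'.1 := by
    intro k k' hk hk' he hlt
    have h0 := hH0 k
    have h0' := hH0 k'
    have h1 := mul_lt_of_stageOf_eq hr0 hr1 (hρpos k') hn hk hk'
    set t : ℝ := H k' / H k with ht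
    have htH : H k' = t * H k := by rw [ht]; field_simp
    have ht1 : r⁻¹ ≤ t := by
      rw [ht, le_div_iff₀ h0, hH, hH, ← pow_succ']
      exact pow_le_pow_right₀ hR1 hlt
    have ht1' : 1 ≤ t := hR1.trans ht1
    have ht0 : 0 < t := by linarith
    have hvv : v k' ≤ t * v k := by
      rw [hv, hv, mul_min_of_nonneg _ _ ht0.le, he, htH]
      gcongr
      exact le_mul_of_one_le_left (by positivity) ht1'
    have hvj : v k' ^ j ≤ t ^ j * v k ^ j := by
      rw [← Real.mul_rpow ht0.le (hv0 k).le]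
      exact Real.rpow_le_rpow (hv0 k').le hvv hj.le
    have hSS : S k' = t ^ i * S k := by
      rw [hS, hS, he, htH, Real.mul_rpow ht0.le h0.le]
      ring
    have hti : t ^ j ≤ t ^ i := Real.rpow_le_rpow_of_exponent_le ht1' hji
    have := hS0 k
    have := hv0 k
    have := hv0 k'
    have h2 : c * v k' ^ j / 8 / (H k' * S k') ≤ r * (c * v k ^ j / 8 / (H k * S k)) := by
      have hrt : 1 ≤ r * t := by
        rwa [inv_le_iff_one_le_mul₀ hr0, mul_comm] at ht1
      rw [hSS, htH, div_le_iff₀ (by positivity)]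
      calc c * v k' ^ j / 8 ≤ c * (t ^ i * v k ^ j) / 8 := by
            gcongr
            exact hvj.trans (by gcongr)
        _ ≤ r * t * (c * (t ^ i * v k ^ j) / 8) := le_mul_of_one_le_left (by positivity) hrt
        _ = _ := by field_simp
    linarith
  -- A line interval is shorter than the ball at its stage by a factor of order `v ^ j`. Each term
  -- of the minimum makes this gain geometric in one index, and a stage contains at most one class
  -- for each value of that index.
  have hw : ∀ k : ℕ × ℕ, κ' * H k ^ ε ≤ H k * S k ∧
      stageOf r ρ₀ (c * v k ^ j / 8 / (H k * S k)) = n →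
      (c * r⁻¹ / (H k * S k)) ^ η ≤
        (8 * r⁻¹ / r) ^ η * (8 * G ^ 3) ^ (j * η) * c ^ (j * η) * (ρ₀ * r ^ n) ^ η *
          (r ^ (j * η)) ^ k.2 +
        (8 * r⁻¹ / r) ^ η * (4 * G ^ 2 / κ') ^ (j * η / 4) * c ^ (j * η / 4) * (ρ₀ * r ^ n) ^ η *
          (r ^ (j * η / 2)) ^ k.1 := by
    rintro k ⟨hk, hkn⟩
    have h0 := hH0 k
    have h1 := hS0 k
    have h2 := hv0 k
    have h3 := rpow_le_of_stageOf_eq (w := c * r⁻¹ / (H k * S k)) (C := 8 * r⁻¹ / v k ^ j)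
      hr0 hρ₀ hη (by positivity) (by positivity) hn hkn (le_of_eq (by field_simp))
    refine h3.trans ?_
    have e1 : (8 * r⁻¹ / v k ^ j / r) ^ η = (8 * r⁻¹ / r) ^ η * ((v k)⁻¹) ^ (j * η) := by
      rw [Real.rpow_mul (by positivity), ← Real.mul_rpow (by positivity) (by positivity),
        Real.inv_rpow h2.le]
      congr 1
      ring
    have e2 : ((v k)⁻¹) ^ (j * η) ≤ (8 * G ^ 3) ^ (j * η) * c ^ (j * η) * (r ^ (j * η)) ^ k.2 +
        (4 * G ^ 2 / κ') ^ (j * η / 4) * c ^ (j * η / 4) * (r ^ (j * η / 2)) ^ k.1 := by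
      rcases min_choice ((r⁻¹) ^ k.2 / (8 * G ^ 3 * c)) (H k) with hmin | hmin
      · refine le_trans (le_of_eq ?_) (le_add_of_nonneg_right (by positivity))
        rw [hv, hmin, inv_div, inv_pow, div_inv_eq_mul, ← hrpow, Real.mul_rpow (by positivity)
          (by positivity), Real.mul_rpow (by positivity) hc.le]
      · refine le_trans ?_ (le_add_of_nonneg_left (by positivity))
        rw [hv, hmin, hH, inv_pow, inv_inv, ← hrpow]
        have e3 : (r ^ k.1) ^ (j * η) = ((r ^ k.1) ^ 2) ^ (j * η / 4) * (r ^ k.1) ^ (j * η / 2) := by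
          rw [← Real.rpow_natCast _ 2, ← Real.rpow_mul (by positivity),
            ← Real.rpow_add (by positivity)]
          congr 1
          push_cast
          ring
        rw [e3, ← Real.mul_rpow (by positivity) hc.le]
        gcongr
        refine (hlarge k hk).trans ?_
        rw [div_mul_eq_mul_div (4 * G ^ 2) κ' c]
        exact mul_le_of_le_one_right (by positivity) (pow_le_one₀ hr0.le hr1.le)
    rw [e1]
    calc (8 * r⁻¹ / r) ^ η * ((v k)⁻¹) ^ (j * η) * (ρ₀ * r ^ n) ^ η
        ≤ (8 * r⁻¹ / r) ^ η * ((8 * G ^ 3) ^ (j * η) * c ^ (j * η) * (r ^ (j * η)) ^ k.2 +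
        (4 * G ^ 2 / κ') ^ (j * η / 4) * c ^ (j * η / 4) * (r ^ (j * η / 2)) ^ k.1) *
          (ρ₀ * r ^ n) ^ η := by gcongr
      _ = _ := by ring
  set M₁ := (8 * r⁻¹ / r) ^ η * (8 * G ^ 3) ^ (j * η) * c ^ (j * η) * (ρ₀ * r ^ n) ^ η with hM₁
  set M₂ := (8 * r⁻¹ / r) ^ η * (4 * G ^ 2 / κ') ^ (j * η / 4) * c ^ (j * η / 4) *
    (ρ₀ * r ^ n) ^ η with hM₂
  set s := {k | κ' * H k ^ ε ≤ H k * S k ∧ stageOf r ρ₀ (c * v k ^ j / 8 / (H k * S k)) = n}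
  have hw' : ∀ k : s, ENNReal.ofReal ((c * r⁻¹ / (H k * S k)) ^ η) ≤
      ENNReal.ofReal (M₁ * (r ^ (j * η)) ^ k.1.2) +
        ENNReal.ofReal (M₂ * (r ^ (j * η / 2)) ^ k.1.1) := fun k =>
    (ENNReal.ofReal_le_ofReal (hw k k.2)).trans ENNReal.ofReal_add_le
  refine (ENNReal.tsum_le_tsum hw').trans ?_
  rw [ENNReal.tsum_add]
  refine (add_le_add
    (tsum_subtype_ofReal_le_geometric (s := s) (w := fun k => M₁ * (r ^ (j * η)) ^ k.2)
      (g := fun k : ℕ × ℕ => k.2) (by positivity) (by positivity)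
      (hlt1 _ hjη) ?_ fun k _ => le_rfl)
    (tsum_subtype_ofReal_le_geometric (s := s) (w := fun k => M₂ * (r ^ (j * η / 2)) ^ k.1)
      (g := fun k : ℕ × ℕ => k.1) (by positivity) (by positivity)
      (hlt1 _ (by linarith)) ?_ fun k _ => le_rfl)).trans ?_
  · rintro k ⟨-, hk⟩ k' ⟨-, hk'⟩ he
    have h1 := inj₁ k k' hk hk' he
    have h2 := inj₁ k' k hk' hk he.symm
    exact Prod.ext (by omega) he
  · rintro k ⟨-, hk⟩ k' ⟨-, hk'⟩ he
    have h1 := inj₂ k k' hk hk' he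
    have h2 := inj₂ k' k hk' hk he.symm
    exact Prod.ext he (by omega)
  · have i1 : 0 ≤ (1 - r ^ (j * η))⁻¹ := inv_nonneg.2 (by linarith [hlt1 _ hjη])
    have i2 : 0 ≤ (1 - r ^ (j * η / 2))⁻¹ :=
      inv_nonneg.2 (by linarith [hlt1 (j * η / 2) (by linarith)])
    rw [← ENNReal.ofReal_add (by positivity) (by positivity)]
    apply ENNReal.ofReal_le_ofReal
    have hp : 0 ≤ (ρ₀ * r ^ n) ^ η := by positivity
    have := mul_le_mul_of_nonneg_right (add_le_add t2 t3) hp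
    linarith

/-! ### Badly approximable parameters form a winning set -/

/-- The parameters `t` for which `(a₁ t + b₁, a₂ t + b₂)` is badly approximable. -/
def badParam (a₁ b₁ a₂ b₂ γ δ i j : ℝ) : Set ℝ :=
  {t | ∃ c : ℝ, 0 < c ∧ ∀ q : ℕ, 0 < q →
    max (distInt (q * (a₁ * t + b₁) - γ) ^ (1 / i)) (distInt (q * (a₂ * t + b₂) - δ) ^ (1 / j)) >
      c / q}

/-- The linear forms with coefficients bounded by `H ^ i`, `H ^ j` do not become small too early on
the line `t ↦ (a₁ t + b₁, a₂ t + b₂)`. -/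
def FormsBoundedBelow (a₁ b₁ a₂ b₂ i j ε : ℝ) : Prop :=
  ∀ M : ℝ, 0 < M → ∃ κ : ℝ, 0 < κ ∧ ∀ H : ℝ, 1 ≤ H → ∀ A B C : ℤ, ¬ (A = 0 ∧ B = 0) →
    |(A : ℝ)| ≤ H ^ i → |(B : ℝ)| ≤ H ^ j →
      κ * H ^ ε ≤ H * |a₁ * A + a₂ * B| ∨
        ∀ t, |t| ≤ M → κ / H ≤ |lineForm a₁ b₁ a₂ b₂ A B C t|

theorem pointSet_subset_pointSet {a₁ b₁ a₂ b₂ γ δ c X Y c' X' Y' : ℝ} {p r q : ℤ}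
    (hX : c / X ≤ c' / X') (hY : c / Y ≤ c' / Y') :
    pointSet a₁ b₁ a₂ b₂ γ δ c X Y p r q ⊆ pointSet a₁ b₁ a₂ b₂ γ δ c' X' Y' p r q :=
  fun _ h => ⟨h.1.trans hX, h.2.trans hY⟩

theorem distInt_nonneg (t : ℝ) : 0 ≤ distInt t := abs_nonneg _

/-- Each `q` lies between consecutive powers of `R`. The constant `c ^ (1 / j)` serves both
coordinates: its power `s ≥ j` is at most `c`, as `c ≤ 1`. -/
theorem mem_badParam_of_forall_notMem_pointSet {a₁ b₁ a₂ b₂ γ δ i j c R t : ℝ} (hj : 0 < j)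
    (hji : j ≤ i) (hc0 : 0 < c) (hc1 : c ≤ 1) (hR : 1 < R)
    (h : ∀ (n : ℕ) (p r q : ℤ), R ^ n ≤ q → q ≤ R * R ^ n →
      t ∉ pointSet a₁ b₁ a₂ b₂ γ δ c ((R ^ n) ^ i) ((R ^ n) ^ j) p r q) :
    t ∈ badParam a₁ b₁ a₂ b₂ γ δ i j := by
  have hi : 0 < i := hj.trans_le hji
  refine ⟨c ^ (1 / j), by positivity, fun q hq => ?_⟩
  by_contra! hle
  have hq1 : (1 : ℝ) ≤ q := by exact_mod_cast hq
  have hq0 : (0 : ℝ) < q := by linarith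
  obtain ⟨n, hn, hn'⟩ := exists_nat_pow_near hq1 hR
  have key : ∀ x s : ℝ, 0 ≤ x → j ≤ s → x ^ (1 / s) ≤ c ^ (1 / j) / q → x ≤ c / (R ^ n) ^ s := by
    intro x s hx hs hxs
    have hs0 : 0 < s := hj.trans_le hs
    have h1 := Real.rpow_le_rpow (by positivity) hxs hs0.le
    rw [← Real.rpow_mul hx, one_div_mul_cancel hs0.ne', Real.rpow_one,
      Real.div_rpow (by positivity) hq0.le, ← Real.rpow_mul hc0.le] at h1
    refine h1.trans ?_
    have h2 : c ^ (1 / j * s) ≤ c ^ (1 : ℝ) := by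
      apply Real.rpow_le_rpow_of_exponent_ge hc0 hc1
      rw [one_div_mul_eq_div, le_div_iff₀ hj]
      linarith
    rw [Real.rpow_one] at h2
    have : 0 < R := by linarith
    gcongr
  refine h n (round (q * (a₁ * t + b₁) - γ)) (round (q * (a₂ * t + b₂) - δ)) q
    (by exact_mod_cast hn) ?_ ⟨?_, ?_⟩
  · push_cast
    rw [pow_succ'] at hn'
    exact hn'.le
  · exact key _ _ (distInt_nonneg _) hji ((le_max_left _ _).trans hle)
  · exact key _ _ (distInt_nonneg _) le_rfl ((le_max_right _ _).trans hle)

theorem tendsto_mul_const_nhdsGT_zero {a : ℝ} (ha : 0 < a) :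
    Tendsto (fun c : ℝ => c * a) (𝓝[>] 0) (𝓝[>] 0) := by
  refine tendsto_nhdsWithin_iff.2 ⟨?_, ?_⟩
  · have : Tendsto (fun c : ℝ => c * a) (𝓝 0) (𝓝 (0 * a)) := tendsto_id.mul_const a
    rw [zero_mul] at this
    exact this.mono_left nhdsWithin_le_nhds
  · filter_upwards [self_mem_nhdsWithin] with c hc using mul_pos hc ha

theorem eventually_le_nhdsGT_zero {a : ℝ} (ha : 0 < a) : ∀ᶠ c : ℝ in 𝓝[>] 0, c ≤ a :=
  nhdsWithin_le_nhds (eventually_le_nhds ha)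

theorem exists_le_rpow {r : ℝ} (hr0 : 0 < r) (hr1 : r < 1) :
    ∃ η : ℝ, 0 < η ∧ 3 / 4 ≤ r ^ η := by
  refine ⟨Real.log (3 / 4) / Real.log r,
    div_pos_of_neg_of_neg (Real.log_neg (by norm_num) (by norm_num)) (Real.log_neg hr0 hr1), ?_⟩
  rw [Real.rpow_def_of_pos hr0, mul_div_cancel₀ _ (Real.log_neg hr0 hr1).ne,
    Real.exp_log (by norm_num)]

theorem ENNReal.tsum_sum_fiber {K L : Type} (f : K ⊕ L → ENNReal) (g : K ⊕ L → ℕ) (n : ℕ) :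
    ∑' k : {k | g k = n}, f k = ∑' k : {k | g (Sum.inl k) = n}, f (Sum.inl (k : K)) +
      ∑' k : {k | g (Sum.inr k) = n}, f (Sum.inr (k : L)) := by
  rw [tsum_subtype, ENNReal.summable.tsum_sum ENNReal.summable,
    tsum_subtype {k | g (Sum.inl k) = n} fun k => f (Sum.inl k),
    tsum_subtype {k | g (Sum.inr k) = n} fun k => f (Sum.inr k)]
  rfl

theorem mul_rpow_lt_of_lt {r i : ℝ} (hr0 : 0 < r) (hr1 : r < 1) (hi : 0 < i) {h h' : ℕ}
    (hh : h < h') : (r⁻¹) ^ h * ((r⁻¹) ^ h) ^ i ≤ r * ((r⁻¹) ^ h' * ((r⁻¹) ^ h') ^ i) := by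
  have hR1 : 1 ≤ r⁻¹ := (one_le_inv₀ hr0).2 hr1.le
  have h1 : (r⁻¹) ^ (h + 1) ≤ (r⁻¹) ^ h' := pow_le_pow_right₀ hR1 hh
  have h2 : (r⁻¹) ^ h ≤ (r⁻¹) ^ h' := pow_le_pow_right₀ hR1 hh.le
  calc (r⁻¹) ^ h * ((r⁻¹) ^ h) ^ i = r * ((r⁻¹) ^ (h + 1) * ((r⁻¹) ^ h) ^ i) := by
        rw [pow_succ]; field_simp
    _ ≤ _ := by gcongr

section Localization

variable {a₁ b₁ a₂ b₂ i j G H r x ρ : ℝ}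

theorem rpow_mul_rpow_of_add_eq_one (hij : i + j = 1) (hH : 0 < H) : H ^ i * H ^ j = H := by
  rw [← Real.rpow_add hH, hij, Real.rpow_one]

/-- A line through two distinct points would be close to the given line on the whole ball. The
Diophantine alternative leaves only a slope large enough for a dangerous class of lines, and no set
of such a class contains the ball. -/
theorem exists_closedBall_point_class {c T κ M ε : ℝ} (hj : 0 < j) (hji : j ≤ i)
    (hij : i + j = 1) (ha₁ : |a₁| ≤ G) (ha₁' : 1 ≤ G * |a₁|) (ha₂ : |a₂| ≤ G) (hG : 4 ≤ G)
    (hH : 1 ≤ H) (hr0 : 0 < r) (hr1 : r < 1) (hc : 0 < c) (hcT : c ≤ T) (hT : 6 * G ^ 3 * T ≤ 1)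
    (hκ : 0 < κ) (hcκ : c < κ) (hx : |x| ≤ M) (hρ0 : 0 ≤ ρ) (hρ : ρ * (H * H ^ i) ≤ T)
    (hdio : ∀ A B C : ℤ, ¬ (A = 0 ∧ B = 0) → |(A : ℝ)| ≤ H ^ i → |(B : ℝ)| ≤ H ^ j →
      κ * H ^ ε ≤ H * |a₁ * A + a₂ * B| ∨
        ∀ t, |t| ≤ M → κ / H ≤ |lineForm a₁ b₁ a₂ b₂ A B C t|)
    (hline : ∀ (A B C : ℤ) (l : ℕ), |(A : ℝ)| ≤ H ^ i → |(B : ℝ)| ≤ H ^ j →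
      κ * H ^ ε ≤ H * (4 * G ^ 2 * c * H ^ i * r ^ l) →
      4 * G ^ 2 * c * H ^ i * r ^ l / r⁻¹ < |a₁ * A + a₂ * B| →
      |a₁ * A + a₂ * B| ≤ 4 * G ^ 2 * c * H ^ i * r ^ l →
      ¬ closedBall x ρ ⊆ {t | |lineForm a₁ b₁ a₂ b₂ A B C t| ≤ c / H}) :
    ∃ z, ∀ p r q : ℤ, H ≤ q → q ≤ G * H →
      pointSet a₁ b₁ a₂ b₂ 0 0 c (H ^ i) (H ^ j) p r q ∩ closedBall x ρ ⊆
        closedBall z (c * G / (H * H ^ i)) := by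
  have hH0 : 0 < H := by linarith
  have hXY := rpow_mul_rpow_of_add_eq_one hij hH0
  have h := exists_closedBall_of_pointSet (b₁ := b₁) (b₂ := b₂) (x := x) (ρ := ρ) ha₁ ha₁' ha₂ hG
    (Real.one_le_rpow hH hj.le) (Real.rpow_le_rpow_of_exponent_le hH hji) hc hcT hT
    (by rwa [hXY])
  rw [hXY] at h
  refine h fun A B C hA hB hs h0 hsub => ?_
  have hxJ : x ∈ closedBall x ρ := mem_closedBall_self hρ0
  rcases hdio A B C h0 hA hB with h1 | h1
  · have hG0 : 0 < G := by linarith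
    set S := 4 * G ^ 2 * c * H ^ i with hS
    have hS0 : 0 < S := by positivity
    have hpos : 0 < |a₁ * A + a₂ * B| := by
      have : 0 < H * |a₁ * A + a₂ * B| := lt_of_lt_of_le (by positivity) h1
      exact pos_of_mul_pos_right this hH0.le
    -- The slope index `l` is read off from `S * r ^ (l + 1) < |slope| ≤ S * r ^ l`.
    obtain ⟨l, hl, hl'⟩ := exists_nat_pow_near_of_lt_one (x := |a₁ * A + a₂ * B| / S) (y := r)
      (by positivity) ((div_le_one hS0).2 hs) hr0 hr1
    rw [lt_div_iff₀ hS0] at hl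
    rw [div_le_iff₀ hS0] at hl'
    refine hline A B C l hA hB (h1.trans ?_) ?_ ?_ hsub
    · gcongr
      linarith
    · rw [div_inv_eq_mul]
      rw [pow_succ] at hl
      linarith
    · linarith
  · have h2 := h1 x hx
    have h3 := hsub x hxJ
    have h4 : c / H < κ / H := by gcongr
    linarith

/-- The common point of two lines of the class would have height at most `H / v`. As dangerous sets
of points are larger at smaller height, the ball may have a radius larger by the factor `v ^ j` and
still lie in one of them, which is excluded. -/
theorem exists_closedBall_line_class {c v S : ℝ} {l : ℕ} (hj : 0 < j) (hji : j ≤ i)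
    (hij : i + j = 1) (ha₁' : 1 ≤ G * |a₁|) (hG : 4 ≤ G) (hH : 1 ≤ H) (hr0 : 0 < r) (hr1 : r < 1)
    (hrG : r⁻¹ ≤ G) (hc : 0 < c) (hc1 : c < 1) (hS : S = 4 * G ^ 2 * c * H ^ i * r ^ l)
    (hv0 : 1 ≤ v) (hv : 8 ≤ v ^ j) (hvl : v ≤ (r⁻¹) ^ l / (8 * G ^ 3 * c)) (hvH : v ≤ H)
    (hρ0 : 0 ≤ ρ) (hρ : ρ ≤ c * v ^ j / 8 / (H * S))
    (hpoint : ∀ (h : ℕ) (p s q : ℤ), (r⁻¹) ^ h ≤ q → q ≤ G * (r⁻¹) ^ h →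
      ¬ closedBall x ρ ⊆ pointSet a₁ b₁ a₂ b₂ 0 0 c (((r⁻¹) ^ h) ^ i) (((r⁻¹) ^ h) ^ j) p s q) :
    ∃ z, ∀ A B C : ℤ, |(A : ℝ)| ≤ H ^ i → |(B : ℝ)| ≤ H ^ j → S / r⁻¹ < |a₁ * A + a₂ * B| →
      |a₁ * A + a₂ * B| ≤ S →
      {t | |lineForm a₁ b₁ a₂ b₂ A B C t| ≤ c / H} ∩ closedBall x ρ ⊆
        closedBall z (c * r⁻¹ / (H * S)) := by
  have hH0 : 0 < H := by linarith
  have hG0 : 0 < G := by linarith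
  have hXY := rpow_mul_rpow_of_add_eq_one hij hH0
  have hS0 : 0 < S := by rw [hS]; positivity
  have hvj : v ^ j ≤ H ^ j := Real.rpow_le_rpow (by linarith) hvH hj.le
  have hcv : 0 < c * v ^ j := by positivity
  have h := exists_closedBall_of_lineForm (a₁ := a₁) (b₁ := b₁) (a₂ := a₂) (b₂ := b₂) (c := c)
    (G := G) (R := r⁻¹) (S := S) (W := 3 * (c * v ^ j) / 8) (X := H ^ i) (Y := H ^ j) (x := x)
    (ρ := ρ) ha₁' hG (Real.one_le_rpow hH hj.le) (Real.rpow_le_rpow_of_exponent_le hH hji)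
    (by positivity) hS0 ?_ ?_ hρ0 ?_
  · rwa [hXY] at h
  · rw [hXY]
    rw [le_div_iff₀ (by positivity)] at hρ
    nlinarith
  · nlinarith
  · intro p s q hq hqS hsub
    have hq1 : (1 : ℝ) ≤ q := by exact_mod_cast hq
    have hR1 : 1 < r⁻¹ := (one_lt_inv₀ hr0).2 hr1
    obtain ⟨h', hh, hh'⟩ := exists_nat_pow_near hq1 hR1
    set H' := (r⁻¹) ^ h' with hH'
    have hH'0 : 0 < H' := by positivity
    have hvH' : v * H' ≤ H := by
      have h1 : (q : ℝ) ≤ 8 * G ^ 3 * c * r ^ l * H := by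
        calc (q : ℝ) ≤ 2 * G * S * H ^ j := hqS
          _ = 8 * G ^ 3 * c * r ^ l * (H ^ i * H ^ j) := by rw [hS]; ring
          _ = _ := by rw [hXY]
      calc v * H' ≤ (r⁻¹) ^ l / (8 * G ^ 3 * c) * (8 * G ^ 3 * c * r ^ l * H) := by
            gcongr
            exact hh.trans h1
        _ = H := by
            rw [inv_pow]; field_simp
    have key : ∀ u : ℝ, j ≤ u → 2 * (3 * (c * v ^ j) / 8) / H ^ u ≤ c / H' ^ u := by
      intro u hu
      have hu0 : 0 < u := hj.trans_le hu
      have h1 : v ^ u * H' ^ u ≤ H ^ u := by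
        rw [← Real.mul_rpow (by linarith) hH'0.le]
        exact Real.rpow_le_rpow (by positivity) hvH' hu0.le
      have h2 : v ^ j ≤ v ^ u := Real.rpow_le_rpow_of_exponent_le hv0 hu
      rw [div_le_div_iff₀ (by positivity) (by positivity)]
      calc 2 * (3 * (c * v ^ j) / 8) * H' ^ u ≤ c * v ^ j * H' ^ u :=
            mul_le_mul_of_nonneg_right (by linarith) (by positivity)
        _ ≤ c * (v ^ u * H' ^ u) := by
            rw [mul_assoc]; gcongr
        _ ≤ _ := by gcongr
    refine hpoint h' p s q hh ?_ (hsub.trans (pointSet_subset_pointSet (key i hji) (key j le_rfl)))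
    rw [pow_succ'] at hh'
    exact hh'.le.trans (by gcongr)

/-- The difference of two shifted points may have height up to `G * H`. This costs at most a factor
`G`, which is why the scale `c / (6 * G ^ 3)` carries one more power of `G` than the general lemma
needs. -/
theorem exists_closedBall_shift_class {γ δ c c₂ : ℝ} (hj : 0 < j) (hji : j ≤ i)
    (hij : i + j = 1) (ha₁ : |a₁| ≤ G) (ha₁' : 1 ≤ G * |a₁|) (ha₂ : |a₂| ≤ G) (hG : 4 ≤ G)
    (hH : 1 ≤ H) (hr0 : 0 < r) (hr1 : r < 1) (hrG : r⁻¹ ≤ G) (hc1 : c < 1)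
    (hc₂ : 0 < c₂) (hcc : c₂ ≤ c / (6 * G ^ 3)) (hρ0 : 0 ≤ ρ)
    (hρ : ρ * (H * H ^ i) ≤ c / (6 * G ^ 3))
    (hpoint : ∀ (h : ℕ) (p s q : ℤ), (r⁻¹) ^ h ≤ q → q ≤ G * (r⁻¹) ^ h →
      ¬ closedBall x ρ ⊆ pointSet a₁ b₁ a₂ b₂ 0 0 c (((r⁻¹) ^ h) ^ i) (((r⁻¹) ^ h) ^ j) p s q) :
    ∃ z, ∀ p s q : ℤ, H ≤ q → q ≤ G * H →
      pointSet a₁ b₁ a₂ b₂ γ δ c₂ (H ^ i) (H ^ j) p s q ∩ closedBall x ρ ⊆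
        closedBall z (c₂ * G / (H * H ^ i)) := by
  have hH0 : 0 < H := by linarith
  have hG0 : 0 < G := by linarith
  have hXY := rpow_mul_rpow_of_add_eq_one hij hH0
  have hc0 : 0 < c := by
    have := hc₂.trans_le hcc
    rw [lt_div_iff₀ (by positivity)] at this
    linarith
  have e : 6 * G ^ 2 * (c / (6 * G ^ 3)) = c / G := by field_simp
  have h := exists_closedBall_of_pointSet_shift (γ := γ) (δ := δ) (b₁ := b₁) (b₂ := b₂) (x := x)
    (ρ := ρ) ha₁ ha₁' ha₂ hG (Real.one_le_rpow hH hj.le) (Real.rpow_le_rpow_of_exponent_le hH hji)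
    hc₂ hcc ?_ (by rwa [hXY]) hρ0 ?_
  · rwa [hXY] at h
  · rw [e, div_lt_one hG0]
    linarith
  · intro p s q hq hqG hsub
    rw [hXY] at hqG
    rw [e] at hsub
    have hq1 : (1 : ℝ) ≤ q := by exact_mod_cast hq
    have hR1 : 1 < r⁻¹ := (one_lt_inv₀ hr0).2 hr1
    obtain ⟨h', hh, hh'⟩ := exists_nat_pow_near hq1 hR1
    set H' := (r⁻¹) ^ h' with hH'
    have hH'0 : 0 < H' := by positivity
    have key : ∀ u : ℝ, j ≤ u → u ≤ 1 → c / G / H ^ u ≤ c / H' ^ u := by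
      intro u hu hu1
      have hu0 : 0 < u := hj.trans_le hu
      have h1 : H' ^ u ≤ G ^ u * H ^ u := by
        rw [← Real.mul_rpow hG0.le hH0.le]
        exact Real.rpow_le_rpow hH'0.le (hh.trans hqG) hu0.le
      have h2 : G ^ u ≤ G := by
        calc G ^ u ≤ G ^ (1 : ℝ) := Real.rpow_le_rpow_of_exponent_le (by linarith) hu1
          _ = G := Real.rpow_one G
      rw [div_div]
      gcongr
      exact h1.trans (by gcongr)
    refine hpoint h' p s q hh ?_ (hsub.trans (pointSet_subset_pointSet (key i hji (by linarith))
      (key j le_rfl (by linarith))))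
    rw [pow_succ'] at hh'
    exact hh'.le.trans (by gcongr)

end Localization

theorem isAlphaBetaWinning_badParam {β i j a₁ b₁ a₂ b₂ ε : ℝ} (hβ0 : 0 < β) (hβ1 : β < 1)
    (hj : 0 < j) (hji : j ≤ i) (hij : i + j = 1) (ha₁ : a₁ ≠ 0) (hε : 0 < ε)
    (hdio : FormsBoundedBelow a₁ b₁ a₂ b₂ i j ε) (γ δ : ℝ) :
    IsAlphaBetaWinning (1 / 2) β (badParam a₁ b₁ a₂ b₂ γ δ i j) := by
  apply isAlphaBetaWinning_of_isAvoidable hβ0 hβ1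
  intro x₀ ρ₀ hρ₀
  have hi : 0 < i := hj.trans_le hji
  set r : ℝ := (β / 2) ^ 2 with hr
  have hr0 : 0 < r := by positivity
  have hr1 : r < 1 := by rw [hr]; nlinarith
  have hR1 : 1 < r⁻¹ := (one_lt_inv₀ hr0).2 hr1
  obtain ⟨η, hη, hrη⟩ := exists_le_rpow hr0 hr1
  set G : ℝ := 4 + r⁻¹ + |a₁| + |a₂| + |a₁|⁻¹ with hG
  have ha₁0 : 0 < |a₁| := abs_pos.2 ha₁
  have ha₁i : 0 < |a₁|⁻¹ := inv_pos.2 ha₁0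
  have ha₂0 : 0 ≤ |a₂| := abs_nonneg a₂
  have hG4 : 4 ≤ G := by linarith
  have hG0 : 0 < G := by linarith
  have hGa₁ : |a₁| ≤ G := by linarith
  have hGa₂ : |a₂| ≤ G := by linarith
  have hGr : r⁻¹ ≤ G := by linarith
  have hGa₁' : 1 ≤ G * |a₁| := by
    calc (1 : ℝ) = |a₁|⁻¹ * |a₁| := (inv_mul_cancel₀ ha₁0.ne').symm
      _ ≤ G * |a₁| := by gcongr; linarith
  obtain ⟨κ', hκ', hdio⟩ := hdio (|x₀| + ρ₀) (by positivity)
  -- The weight allowed at a stage is shared equally by unshifted points, lines and shifted points.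
  set κ : ℝ := (β / 4) ^ η / 3 / 3 with hκ
  have hκ0 : 0 < κ := by positivity
  set T : ℝ := 1 / (6 * G ^ 3) with hT
  have hT0 : 0 < T := by positivity
  set V : ℝ := 8 ^ (1 / j) with hV
  have hV1 : 1 ≤ V := Real.one_le_rpow (by norm_num) (by positivity)
  have hV0 : 0 < V := by linarith
  have hV8 : V ^ j = 8 := by
    rw [hV, ← Real.rpow_mul (by norm_num), one_div_mul_cancel hj.ne', Real.rpow_one]
  set H : ℕ → ℝ := fun h => (r⁻¹) ^ h with hHdef
  have hH1 : ∀ h, 1 ≤ H h := fun h => one_le_pow₀ hR1.le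
  have hH0 : ∀ h, 0 < H h := fun h => zero_lt_one.trans_le (hH1 h)
  have hZ0 : ∀ h, (r⁻¹) ^ h ≤ H h * H h ^ i := fun h =>
    le_mul_of_one_le_right (hH0 h).le (Real.one_le_rpow (hH1 h) hi.le)
  have hZ : ∀ h h', h < h' → H h * H h ^ i ≤ r * (H h' * H h' ^ i) := fun h h' =>
    mul_rpow_lt_of_lt hr0 hr1 hi
  have hZpos : ∀ h, 0 < H h * H h ^ i := fun h => by
    have := hH0 h
    positivity
  -- the constants of the classes
  obtain ⟨c, hc0, hcP, hcL, hcT, hcκ, hc1, hcV, hcV'⟩ : ∃ c : ℝ, 0 < c ∧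
      (∀ n, ∑' h : {h | stageOf r ρ₀ (T / (H h * H h ^ i)) = n},
        ENNReal.ofReal ((c * G / (H h * H h ^ i)) ^ η) ≤
          ENNReal.ofReal (κ * (ρ₀ * r ^ n) ^ η)) ∧
      (∀ (H S v : ℕ × ℕ → ℝ),
        (∀ k, H k = (r⁻¹) ^ k.1) → (∀ k, S k = 4 * G ^ 2 * c * H k ^ i * r ^ k.2) →
        (∀ k, v k = min ((r⁻¹) ^ k.2 / (8 * G ^ 3 * c)) (H k)) →
        ∀ n, ∑' k : {k | κ' * H k ^ ε ≤ H k * S k ∧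
            stageOf r ρ₀ (c * v k ^ j / 8 / (H k * S k)) = n},
          ENNReal.ofReal ((c * r⁻¹ / (H k * S k)) ^ η) ≤ ENNReal.ofReal (κ * (ρ₀ * r ^ n) ^ η)) ∧
      c ≤ T ∧ c ≤ κ' / 2 ∧ c ≤ 1 / 2 ∧ c ≤ 1 / (8 * G ^ 3 * V) ∧ c ≤ κ' / (4 * G ^ 2 * V ^ 2) := by
    have e1 := (tendsto_mul_const_nhdsGT_zero hG0).eventually
      (eventually_tsum_point_le hr0 hr1 hρ₀ hη hT0 hκ0 hZ0 hZ)
    have e2 := eventually_tsum_line_le (G := G) hr0 hr1 hρ₀ hη hκ0 hκ' hε hj hji hij (by linarith)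
    have h2 : (0 : ℝ) < 1 / 2 := by norm_num
    obtain ⟨c, hc⟩ := (e1.and (e2.and ((eventually_le_nhdsGT_zero hT0).and
      ((eventually_le_nhdsGT_zero (half_pos hκ')).and ((eventually_le_nhdsGT_zero h2).and
      ((eventually_le_nhdsGT_zero (by positivity : 0 < 1 / (8 * G ^ 3 * V))).and
      ((eventually_le_nhdsGT_zero (by positivity : 0 < κ' / (4 * G ^ 2 * V ^ 2))).and
        self_mem_nhdsWithin))))))).exists
    obtain ⟨c1, c2, c3, c4, c5, c6, c7, c8⟩ := hc
    exact ⟨c, c8, c1, c2, c3, c4, c5, c6, c7⟩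
  -- The constant for shifted points comes after `c`, which fixes the scale at which they are
  -- localized.
  obtain ⟨c₂, hc₂0, hc₂P, hc₂T⟩ : ∃ c₂ : ℝ, 0 < c₂ ∧
      (∀ n, ∑' h : {h | stageOf r ρ₀ (c / (6 * G ^ 3) / (H h * H h ^ i)) = n},
        ENNReal.ofReal ((c₂ * G / (H h * H h ^ i)) ^ η) ≤
          ENNReal.ofReal (κ * (ρ₀ * r ^ n) ^ η)) ∧ c₂ ≤ c / (6 * G ^ 3) := by
    have hT₂ : 0 < c / (6 * G ^ 3) := by positivity
    obtain ⟨c₂, h1, h2, h3⟩ := (((tendsto_mul_const_nhdsGT_zero hG0).eventually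
      (eventually_tsum_point_le hr0 hr1 hρ₀ hη hT₂ hκ0 hZ0 hZ)).and
      ((eventually_le_nhdsGT_zero hT₂).and self_mem_nhdsWithin)).exists
    exact ⟨c₂, h3, h1, h2⟩
  set S : ℕ × ℕ → ℝ := fun k => 4 * G ^ 2 * c * H k.1 ^ i * r ^ k.2 with hSdef
  set v : ℕ × ℕ → ℝ := fun k => min ((r⁻¹) ^ k.2 / (8 * G ^ 3 * c)) (H k.1) with hvdef
  have hS0 : ∀ k, 0 < S k := fun k => by
    have := hH0 k.1
    positivity
  have hHS0 : ∀ k : ℕ × ℕ, 0 < H k.1 * S k := fun k => mul_pos (hH0 _) (hS0 k)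
  have hv0 : ∀ k, 0 < v k := fun k => by
    have := hH0 k.1
    positivity
  -- Only slopes allowed by the Diophantine alternative enter; otherwise the weights would not be
  -- summable.
  let P : Set (ℕ × ℕ) := {k | κ' * H k.1 ^ ε ≤ H k.1 * S k}
  let stage : ℕ ⊕ (P ⊕ ℕ) → ℕ :=
    Sum.elim (fun h => stageOf r ρ₀ (T / (H h * H h ^ i)))
      (Sum.elim (fun k => stageOf r ρ₀ (c * v k.1 ^ j / 8 / (H k.1.1 * S k.1)))
        (fun h => stageOf r ρ₀ (c / (6 * G ^ 3) / (H h * H h ^ i))))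
  let lam : ℕ ⊕ (P ⊕ ℕ) → ℝ :=
    Sum.elim (fun h => c * G / (H h * H h ^ i))
      (Sum.elim (fun k => c * r⁻¹ / (H k.1.1 * S k.1)) (fun h => c₂ * G / (H h * H h ^ i)))
  let D : ℕ ⊕ (P ⊕ ℕ) → Set (Set ℝ) :=
    Sum.elim (fun h => {E | ∃ p s q : ℤ, H h ≤ q ∧ q ≤ G * H h ∧
        E = pointSet a₁ b₁ a₂ b₂ 0 0 c (H h ^ i) (H h ^ j) p s q})
      (Sum.elim (fun k => {E | ∃ A B C : ℤ, |(A : ℝ)| ≤ H k.1.1 ^ i ∧ |(B : ℝ)| ≤ H k.1.1 ^ j ∧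
          S k.1 / r⁻¹ < |a₁ * A + a₂ * B| ∧ |a₁ * A + a₂ * B| ≤ S k.1 ∧
          E = {t | |lineForm a₁ b₁ a₂ b₂ A B C t| ≤ c / H k.1.1}})
        (fun h => {E | ∃ p s q : ℤ, H h ≤ q ∧ q ≤ G * H h ∧
          E = pointSet a₁ b₁ a₂ b₂ γ δ c₂ (H h ^ i) (H h ^ j) p s q}))
  refine ⟨ℕ ⊕ (P ⊕ ℕ), stage, lam, η, D, ⟨hη, hrη, ?_, ?_, ?_, ?_⟩, ?_⟩
  · rintro (h | k | h)
    · exact div_pos (by positivity) (hZpos h)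
    · exact div_pos (by positivity) (hHS0 k.1)
    · exact div_pos (by positivity) (hZpos h)
  · intro n
    rw [ENNReal.tsum_sum_fiber (fun k => ENNReal.ofReal (lam k ^ η)) stage n,
      ENNReal.tsum_sum_fiber (fun k => ENNReal.ofReal (lam (Sum.inr k) ^ η))
        (fun k => stage (Sum.inr k)) n]
    have hL : ∑' k : {k : P | stage (Sum.inr (Sum.inl k)) = n},
        ENNReal.ofReal (lam (Sum.inr (Sum.inl (k : P))) ^ η) ≤
          ENNReal.ofReal (κ * (ρ₀ * r ^ n) ^ η) := by
      refine le_trans ?_ (hcL (fun k => H k.1) S v (fun _ => rfl) (fun _ => rfl) (fun _ => rfl) n)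
      let f : {k : P | stage (Sum.inr (Sum.inl k)) = n} → {k : ℕ × ℕ | κ' * H k.1 ^ ε ≤ H k.1 * S k ∧
          stageOf r ρ₀ (c * v k ^ j / 8 / (H k.1 * S k)) = n} := fun k => ⟨k.1.1, k.1.2, k.2⟩
      have hf : Function.Injective f := fun k k' hkk =>
        Subtype.ext (Subtype.ext (congrArg (fun y => y.1) hkk))
      exact ENNReal.tsum_comp_le_tsum_of_injective hf
        fun k => ENNReal.ofReal ((c * r⁻¹ / (H k.1.1 * S k.1)) ^ η)
    refine (add_le_add (hcP n) (add_le_add hL (hc₂P n))).trans ?_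
    have hp : 0 ≤ κ * (ρ₀ * r ^ n) ^ η := by positivity
    rw [← ENNReal.ofReal_add hp hp, ← ENNReal.ofReal_add hp (add_nonneg hp hp)]
    apply ENNReal.ofReal_le_ofReal
    rw [hκ]
    apply le_of_eq
    ring
  · have hXY := fun h => rpow_mul_rpow_of_add_eq_one hij (hH0 h)
    have hXp : ∀ h, 0 < H h ^ i := fun h => Real.rpow_pos_of_pos (hH0 h) _
    have hYp : ∀ h, 0 < H h ^ j := fun h => Real.rpow_pos_of_pos (hH0 h) _
    rintro (h | k | h)
    · rintro E ⟨p, s, q, hq, -, rfl⟩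
      have := pointSet_subset_closedBall (b₁ := b₁) (a₂ := a₂) (b₂ := b₂) (γ := 0) (δ := 0) (c := c)
        (p := p) (r := s) hGa₁' (hXp h) (hYp h) ((hXY h).trans_le hq)
      rw [hXY] at this
      exact ⟨_, this⟩
    · rintro E ⟨A, B, C, -, -, hs, -, rfl⟩
      exact ⟨_, lineForm_subset_closedBall (by positivity) (hS0 _) (hH0 _) hs⟩
    · rintro E ⟨p, s, q, hq, -, rfl⟩
      have := pointSet_subset_closedBall (b₁ := b₁) (a₂ := a₂) (b₂ := b₂) (γ := γ) (δ := δ)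
        (c := c₂) (p := p) (r := s) hGa₁' (hXp h) (hYp h) ((hXY h).trans_le hq)
      rw [hXY] at this
      exact ⟨_, this⟩
  · have hpoint : ∀ (x ρ : ℝ), (∀ k', ∀ E ∈ D k', ¬ closedBall x ρ ⊆ E) →
        ∀ (h : ℕ) (p s q : ℤ), (r⁻¹) ^ h ≤ q → q ≤ G * (r⁻¹) ^ h →
          ¬ closedBall x ρ ⊆
            pointSet a₁ b₁ a₂ b₂ 0 0 c (((r⁻¹) ^ h) ^ i) (((r⁻¹) ^ h) ^ j) p s q :=
      fun x ρ hD h p s q hq hq' => hD (Sum.inl h) _ ⟨p, s, q, hq, hq', rfl⟩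
    rintro (h | k | h) x hx hD
    · have hZh := hZpos h
      have hst := mul_pow_stageOf_le (ρ₀ := ρ₀) hr0 hr1 (div_pos hT0 hZh)
      have hxM : |x| ≤ |x₀| + ρ₀ := by
        have h1 := hx (mem_closedBall_self (by positivity))
        rw [mem_closedBall, Real.dist_eq] at h1
        have := abs_sub_abs_le_abs_sub x x₀
        linarith
      obtain ⟨z, hz⟩ := exists_closedBall_point_class (H := H h) (x := x) (r := r) (T := T)
        (ρ := ρ₀ * r ^ stage (Sum.inl h)) hj hji hij hGa₁ hGa₁' hGa₂ hG4 (hH1 h) hr0 hr1 hc0 hcT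
        (by rw [hT]; field_simp; rfl) hκ' (by linarith) hxM (by positivity)
        (by rwa [le_div_iff₀ hZh] at hst) (hdio (H h) (hH1 h))
        (fun A B C l hA hB hP hs hs' => hD (Sum.inr (Sum.inl ⟨(h, l), hP⟩)) _
          ⟨A, B, C, hA, hB, hs, hs', rfl⟩)
      refine ⟨z, ?_⟩
      rintro E ⟨p, s, q, hq, hq', rfl⟩
      exact hz p s q hq hq'
    · obtain ⟨⟨h, l⟩, hk⟩ := k
      have hHh := hH0 h
      have hpos : 0 < c * v (h, l) ^ j / 8 / (H h * S (h, l)) :=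
        div_pos (by have := hv0 (h, l); positivity) (hHS0 (h, l))
      -- The first term of the minimum is large because `c` is small. For the second, membership in
      -- `P` gives `κ' ≤ 4 * G ^ 2 * c * H ^ 2`, so a small `c` forces a large height.
      have hvV : V ≤ v (h, l) := by
        refine le_min ?_ ?_
        · have h1 : 1 ≤ (r⁻¹) ^ l := one_le_pow₀ hR1.le
          rw [le_div_iff₀ (by positivity)] at hcV ⊢
          linarith
        · have h1 : κ' * 1 ≤ κ' * H h ^ ε := by
            gcongr
            exact Real.one_le_rpow (hH1 h) hε.le
          have h2 : H h ^ i ≤ H h ^ (1 : ℝ) :=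
            Real.rpow_le_rpow_of_exponent_le (hH1 h) (by linarith)
          rw [Real.rpow_one] at h2
          have h3 : H h * S (h, l) ≤ H h * (4 * G ^ 2 * c * H h * 1) := by
            simp only [hSdef]
            gcongr
            exact pow_le_one₀ hr0.le hr1.le
          have h4 : κ' * H h ^ ε ≤ H h * S (h, l) := hk
          have h5 : κ' ≤ 4 * G ^ 2 * c * H h ^ 2 := by linarith
          rw [le_div_iff₀ (by positivity)] at hcV'
          have h6 : c * (4 * G ^ 2) * V ^ 2 ≤ c * (4 * G ^ 2) * H h ^ 2 := by linarith
          have h7 := le_of_mul_le_mul_left h6 (by positivity)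
          exact le_of_sq_le_sq h7 hHh.le
      obtain ⟨z, hz⟩ := exists_closedBall_line_class (b₁ := b₁) (a₂ := a₂) (b₂ := b₂)
        (H := H h) (x := x) (r := r) (S := S (h, l)) (v := v (h, l)) (c := c) (l := l)
        (ρ := ρ₀ * r ^ stage (Sum.inr (Sum.inl ⟨(h, l), hk⟩))) hj hji hij hGa₁' hG4 (hH1 h) hr0 hr1
        hGr hc0 (by linarith) rfl (hV1.trans hvV)
        (hV8.symm.le.trans (Real.rpow_le_rpow hV0.le hvV hj.le)) (min_le_left _ _) (min_le_right _ _)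
        (by positivity) (mul_pow_stageOf_le hr0 hr1 hpos) (hpoint _ _ hD)
      refine ⟨z, ?_⟩
      rintro E ⟨A, B, C, hA, hB, hs, hs', rfl⟩
      exact hz A B C hA hB hs hs'
    · have hZh := hZpos h
      have hst := mul_pow_stageOf_le (ρ₀ := ρ₀) hr0 hr1
        (div_pos (by positivity : 0 < c / (6 * G ^ 3)) hZh)
      obtain ⟨z, hz⟩ := exists_closedBall_shift_class (γ := γ) (δ := δ) (b₁ := b₁) (b₂ := b₂)
        (H := H h) (x := x) (r := r) (ρ := ρ₀ * r ^ stage (Sum.inr (Sum.inr h))) hj hji hij hGa₁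
        hGa₁' hGa₂ hG4 (hH1 h) hr0 hr1 hGr (by linarith) hc₂0 hc₂T (by positivity)
        (by rwa [le_div_iff₀ hZh] at hst) (hpoint _ _ hD)
      refine ⟨z, ?_⟩
      rintro E ⟨p, s, q, hq, hq', rfl⟩
      exact hz p s q hq hq'
  · intro t _ ht
    have hG3 : c / (6 * G ^ 3) ≤ 1 := by
      rw [div_le_one (by positivity)]
      have : 1 ≤ G ^ 3 := one_le_pow₀ (by linarith)
      linarith
    refine mem_badParam_of_forall_notMem_pointSet hj hji hc₂0 (hc₂T.trans hG3) hR1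
      fun n p s q hq hq' => ht (Sum.inr (Sum.inr n)) _ ⟨p, s, q, hq, hq'.trans ?_, rfl⟩
    have := hH0 n
    gcongr

/-! ### Transfer of the game by similarities -/

section Similarity

variable {X Y : Type*} [MetricSpace X] [MetricSpace Y]

/-- The image of a ball under a similarity. -/
def GameBall.map (e : X → Y) {k : ℝ} (hk : 0 < k) (B : GameBall X) : GameBall Y where
  center := e B.center
  radius := k * B.radius
  radius_pos := mul_pos hk B.radius_pos

theorem GameBall.preimage_toSet_map {e : X → Y} {k : ℝ} (hk : 0 < k)
    (he : ∀ x y, dist (e x) (e y) = k * dist x y) (B : GameBall X) :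
    e ⁻¹' (B.map e hk).toSet = B.toSet := by
  ext x
  simp [GameBall.toSet, GameBall.map, he, hk]

theorem legalMove_map_iff {e : X ≃ Y} {k : ℝ} (hk : 0 < k)
    (he : ∀ x y, dist (e x) (e y) = k * dist x y) {t : ℝ} {B C : GameBall X} :
    LegalMove t (B.map e hk) (C.map e hk) ↔ LegalMove t B C := by
  refine and_congr ?_ ?_
  · rw [← e.preimage_subset, GameBall.preimage_toSet_map hk he, GameBall.preimage_toSet_map hk he]
  · simp only [GameBall.map]
    rw [mul_left_comm]
    exact mul_right_inj' hk.ne'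

/-- Winning sets are preserved by similarities. -/
theorem IsAlphaBetaWinning.of_similarity {e : X ≃ Y} {k : ℝ} (hk : 0 < k)
    (he : ∀ x y, dist (e x) (e y) = k * dist x y) {α β : ℝ} {S : Set Y}
    (h : IsAlphaBetaWinning α β (e ⁻¹' S)) : IsAlphaBetaWinning α β S := by
  obtain ⟨s, hs⟩ := h
  let ψ : GameBall Y → GameBall X := GameBall.map e.symm (inv_pos.2 hk)
  have hψ : ∀ B : GameBall Y, (ψ B).map e hk = B := by
    rintro ⟨c, ρ, hρ⟩
    simp [ψ, GameBall.map, hk.ne']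
  let s' : List (GameBall Y) → GameBall Y := fun l => (s (l.map ψ)).map e hk
  have hs' : ∀ (B : ℕ → GameBall Y) n, answer s' B n = (answer s (fun m => ψ (B m)) n).map e hk := by
    intro B n
    simp only [answer, s', List.map_map]
    rfl
  have hB : ∀ (B : ℕ → GameBall Y) n t, LegalMove t (answer s' B n) (B (n + 1)) ↔
      LegalMove t (answer s (fun m => ψ (B m)) n) (ψ (B (n + 1))) := by
    intro B n t
    conv_lhs => rw [hs', ← hψ (B (n + 1))]
    exact legalMove_map_iff hk he
  have hA : ∀ (B : ℕ → GameBall Y) n t, LegalMove t (B n) (answer s' B n) ↔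
      LegalMove t (ψ (B n)) (answer s (fun m => ψ (B m)) n) := by
    intro B n t
    conv_lhs => rw [hs', ← hψ (B n)]
    exact legalMove_map_iff hk he
  refine ⟨s', fun B => ⟨fun n hn => ?_, fun hn => ?_⟩⟩
  · rw [hA]
    exact (hs fun m => ψ (B m)).1 n fun k hk' => (hB B k β).1 (hn k hk')
  · obtain ⟨x, hx, hxB⟩ := (hs fun m => ψ (B m)).2 fun n => (hB B n β).1 (hn n)
    refine ⟨e x, hx, ?_⟩
    have h1 : e ⁻¹' ⋂ n, (B n).toSet = {x} := by
      rw [Set.preimage_iInter, ← hxB]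
      refine Set.iInter_congr fun n => ?_
      rw [← GameBall.preimage_toSet_map hk he (ψ (B n)), hψ]
    rw [← e.image_preimage (⋂ n, (B n).toSet), h1, Set.image_singleton]

end Similarity

/-! ### From the Diophantine condition to bounds for linear forms -/

theorem distInt_le_abs_add (x : ℝ) (n : ℤ) : distInt x ≤ |x + n| := by
  have := round_le x (-n)
  rwa [Int.cast_neg, sub_neg_eq_add] at this

theorem distInt_natAbs_mul_le (A B : ℤ) (a : ℝ) : distInt (A.natAbs * a) ≤ |A * a + B| := by
  rw [Nat.cast_natAbs, Int.cast_abs]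
  rcases abs_choice (A : ℝ) with h | h
  · rw [h]
    exact distInt_le_abs_add _ _
  · rw [h, ← abs_neg (A * a + B)]
    convert distInt_le_abs_add (-A * a) (-B) using 2
    push_cast
    ring

theorem distInt_eq_zero_iff {x : ℝ} : distInt x = 0 ↔ ∃ n : ℤ, x = n := by
  rw [distInt, abs_eq_zero, sub_eq_zero]
  refine ⟨fun h => ⟨_, h⟩, ?_⟩
  rintro ⟨n, rfl⟩
  rw [round_intCast]

theorem exists_pos_le_of_forall_lt {u : ℕ → ℝ} (hu : ∀ q, 0 < q → 0 < u q) (N : ℕ) :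
    ∃ κ : ℝ, 0 < κ ∧ ∀ q, 0 < q → q < N → κ ≤ u q := by
  induction N with
  | zero => exact ⟨1, one_pos, fun q _ h => absurd h (Nat.not_lt_zero q)⟩
  | succ N ih =>
    obtain ⟨κ, hκ, h⟩ := ih
    by_cases hN : 0 < N
    · refine ⟨min κ (u N), lt_min hκ (hu N hN), fun q hq hqN => ?_⟩
      rcases Nat.lt_succ_iff_lt_or_eq.1 hqN with hlt | rfl
      · exact (min_le_left _ _).trans (h q hq hlt)
      · exact min_le_right _ _
    · exact ⟨1, one_pos, fun q hq hqN => by omega⟩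

/-- The lower limit controls large `q`. For the finitely many others only positivity is needed: if
`q * a` and `q * b` were both integers, so they would be for all multiples of `q`, against the bound
for large ones. -/
theorem DiophantineCondition.exists_le {σ ε a b : ℝ} (h : DiophantineCondition σ ε a b) :
    ∃ κ : ℝ, 0 < κ ∧ ∀ q : ℕ, 0 < q →
      κ ≤ (q : ℝ) ^ (1 / σ - ε) * max (distInt (q * a)) (distInt (q * b)) := by
  obtain ⟨κ, hκ0, hκ⟩ := EReal.lt_iff_exists_real_btwn.1 h
  have hκ0 : 0 < κ := by exact_mod_cast hκ0
  obtain ⟨N, hN⟩ := eventually_atTop.1 (eventually_lt_of_lt_liminf hκ)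
  have hN : ∀ q : ℕ, N ≤ q →
      κ < (q : ℝ) ^ (1 / σ - ε) * max (distInt (q * a)) (distInt (q * b)) := fun q hq =>
    EReal.coe_lt_coe_iff.1 (hN q hq)
  have hpos : ∀ q : ℕ, 0 < q →
      0 < (q : ℝ) ^ (1 / σ - ε) * max (distInt (q * a)) (distInt (q * b)) := by
    intro q hq
    have hq0 : (0 : ℝ) < q := by exact_mod_cast hq
    refine mul_pos (Real.rpow_pos_of_pos hq0 _) ?_
    by_contra! hle
    have hmul : ∀ x : ℝ, distInt (q * x) ≤ 0 → distInt (((N + 1) * q : ℕ) * x) = 0 := by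
      intro x hx
      obtain ⟨n, hn⟩ := distInt_eq_zero_iff.1 (le_antisymm hx (distInt_nonneg _))
      refine distInt_eq_zero_iff.2 ⟨(N + 1) * n, ?_⟩
      push_cast
      rw [mul_assoc, hn]
    have h1 := hN ((N + 1) * q) (by nlinarith)
    rw [hmul a ((le_max_left _ _).trans hle), hmul b ((le_max_right _ _).trans hle), max_self,
      mul_zero] at h1
    linarith
  obtain ⟨κ', hκ', h'⟩ := exists_pos_le_of_forall_lt hpos N
  refine ⟨min κ κ', lt_min hκ0 hκ', fun q hq => ?_⟩
  rcases le_or_gt N q with hle | hlt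
  · exact (min_le_left _ _).trans (hN q hle).le
  · exact (min_le_right _ _).trans (h' q hq hlt)

theorem DiophantineCondition.exists_le_int {σ ε a b : ℝ} (h : DiophantineCondition σ ε a b) :
    ∃ κ : ℝ, 0 < κ ∧ ∀ A B C : ℤ, A ≠ 0 →
      κ ≤ |(A : ℝ)| ^ (1 / σ - ε) * max |A * a + B| |A * b + C| := by
  obtain ⟨κ, hκ, h⟩ := h.exists_le
  refine ⟨κ, hκ, fun A B C hA => (h A.natAbs (Int.natAbs_pos.2 hA)).trans ?_⟩
  rw [Nat.cast_natAbs, Int.cast_abs]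
  gcongr
  · have := distInt_natAbs_mul_le A B a
    rwa [Nat.cast_natAbs, Int.cast_abs] at this
  · have := distInt_natAbs_mul_le A C b
    rwa [Nat.cast_natAbs, Int.cast_abs] at this

/-- The slope and the constant term of a linear form on the line are not both too small. -/
def SlopeOrConstBounded (a₁ b₁ a₂ b₂ i j ε : ℝ) : Prop :=
  ∃ κ : ℝ, 0 < κ ∧ ∀ H : ℝ, 1 ≤ H → ∀ A B C : ℤ, ¬ (A = 0 ∧ B = 0) →
    |(A : ℝ)| ≤ H ^ i → |(B : ℝ)| ≤ H ^ j →
      1 ≤ |a₁ * A + a₂ * B| ∨ κ * H ^ ε ≤ H * max |a₁ * A + a₂ * B| |b₁ * A + b₂ * B + C|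

theorem lineForm_eq (a₁ b₁ a₂ b₂ : ℝ) (A B C : ℤ) (t : ℝ) :
    lineForm a₁ b₁ a₂ b₂ A B C t = (a₁ * A + a₂ * B) * t + (b₁ * A + b₂ * B + C) := by
  simp only [lineForm]
  ring

theorem SlopeOrConstBounded.formsBoundedBelow {a₁ b₁ a₂ b₂ i j ε : ℝ} (hε0 : 0 < ε) (hε1 : ε ≤ 1)
    (h : SlopeOrConstBounded a₁ b₁ a₂ b₂ i j ε) : FormsBoundedBelow a₁ b₁ a₂ b₂ i j ε := by
  obtain ⟨κ, hκ, h⟩ := h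
  intro M hM
  have hmin : 0 < min κ 1 := lt_min hκ one_pos
  -- With this constant, a slope below `m * H ^ (ε - 1)` moves the form by less than half of its
  -- constant term over `|t| ≤ M`.
  refine ⟨min κ 1 / (2 * (M + 1)), by positivity, fun H hH A B C h0 hA hB => ?_⟩
  have hH0 : 0 < H := by linarith
  have hHε : 1 ≤ H ^ ε := Real.one_le_rpow hH hε0.le
  set m := min κ 1 / (2 * (M + 1)) with hm
  have hm0 : 0 < m := by positivity
  have hm1 : m * (2 * (M + 1)) = min κ 1 := by rw [hm]; field_simp
  have hmle : m ≤ min κ 1 := by nlinarith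
  by_cases hs : m * H ^ ε ≤ H * |a₁ * A + a₂ * B|
  · exact Or.inl hs
  · refine Or.inr fun t ht => ?_
    rw [not_le] at hs
    have hH1 : H ^ ε ≤ H := by
      calc H ^ ε ≤ H ^ (1 : ℝ) := Real.rpow_le_rpow_of_exponent_le hH hε1
        _ = H := Real.rpow_one H
    rcases h H hH A B C h0 hA hB with h1 | h1
    · have h2 : m * H ^ ε ≤ 1 * H := by
        gcongr
        exact hmle.trans (min_le_right _ _)
      nlinarith
    · have hκm : min κ 1 * H ^ ε ≤ κ * H ^ ε := by
        gcongr
        exact min_le_left _ _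
      rw [mul_max_of_nonneg _ _ hH0.le] at h1
      rcases le_max_iff.1 h1 with h2 | h2
      · have : m * H ^ ε ≤ min κ 1 * H ^ ε := by gcongr
        linarith
      · rw [lineForm_eq, div_le_iff₀ hH0]
        have h3 : |b₁ * A + b₂ * B + C| ≤
            |(a₁ * A + a₂ * B) * t + (b₁ * A + b₂ * B + C)| + |a₁ * A + a₂ * B| * |t| := by
          rw [← abs_mul]
          have := abs_sub ((a₁ * A + a₂ * B) * t + (b₁ * A + b₂ * B + C)) ((a₁ * A + a₂ * B) * t)
          rwa [add_sub_cancel_left] at this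
        have h4 : |a₁ * A + a₂ * B| * |t| ≤ |a₁ * A + a₂ * B| * M := by gcongr
        have h5 : H * |a₁ * A + a₂ * B| * M ≤ m * H ^ ε * M := by gcongr
        have h6 : H * |b₁ * A + b₂ * B + C| ≤
            H * |(a₁ * A + a₂ * B) * t + (b₁ * A + b₂ * B + C)| + m * H ^ ε * M := by nlinarith
        have h7 : m * (2 * (M + 1)) * H ^ ε ≤ κ * H ^ ε := hm1 ▸ hκm
        have h8 : m * 1 ≤ m * H ^ ε := by gcongr
        have h9 : 0 ≤ m * H ^ ε * M := by positivity
        linarith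

/-- A nonzero slope is at least `d`, which gives the full exponent `1`. With slope zero the form is
constant, and the bound without `ε` is enough. -/
theorem SlopeOrConstBounded.formsBoundedBelow_of_discrete {a₁ b₁ a₂ b₂ i j d : ℝ}
    (h : SlopeOrConstBounded a₁ b₁ a₂ b₂ i j 0) (hd : 0 < d)
    (hdisc : ∀ A B : ℤ, a₁ * A + a₂ * B = 0 ∨ d ≤ |a₁ * A + a₂ * B|) :
    FormsBoundedBelow a₁ b₁ a₂ b₂ i j 1 := by
  obtain ⟨κ, hκ, h⟩ := h
  intro M hM
  refine ⟨min κ d, lt_min hκ hd, fun H hH A B C h0 hA hB => ?_⟩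
  have hH0 : 0 < H := by linarith
  rcases hdisc A B with hs | hs
  · refine Or.inr fun t ht => ?_
    have h1 := h H hH A B C h0 hA hB
    rw [lineForm_eq, hs, zero_mul, zero_add, div_le_iff₀ hH0]
    rw [hs, abs_zero, Real.rpow_zero, mul_one, max_eq_right (abs_nonneg _)] at h1
    rcases h1 with h1 | h1
    · linarith
    · rw [mul_comm]
      exact (min_le_left _ _).trans h1
  · left
    rw [Real.rpow_one, mul_comm H]
    gcongr
    exact (min_le_right _ _).trans hs

/-- The core estimate: `n` is the coefficient to which the Diophantine condition applies. -/
theorem mul_rpow_le_of_le {κ σ ε L H m n : ℝ} (hσ : 0 < σ) (hε : ε ≤ 1 / σ) (hL : 0 < L)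
    (hH : 1 ≤ H) (hm : 0 ≤ m) (hn : 0 ≤ n) (hnL : n ≤ L * H ^ σ) (h : κ ≤ n ^ (1 / σ - ε) * m) :
    κ / L ^ (1 / σ - ε) * H ^ (σ * ε) ≤ H * m := by
  have hH0 : 0 < H := by linarith
  have he : 0 ≤ 1 / σ - ε := by linarith
  have h1 : n ^ (1 / σ - ε) ≤ L ^ (1 / σ - ε) * H ^ (1 - σ * ε) := by
    refine (Real.rpow_le_rpow hn hnL he).trans (le_of_eq ?_)
    rw [Real.mul_rpow hL.le (by positivity), ← Real.rpow_mul hH0.le]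
    congr 2
    field_simp
  have h2 : κ ≤ L ^ (1 / σ - ε) * H ^ (1 - σ * ε) * m := h.trans (by gcongr)
  have h3 : H ^ (1 - σ * ε) * H ^ (σ * ε) = H := by
    rw [← Real.rpow_add hH0, sub_add_cancel, Real.rpow_one]
  calc κ / L ^ (1 / σ - ε) * H ^ (σ * ε)
      ≤ L ^ (1 / σ - ε) * H ^ (1 - σ * ε) * m / L ^ (1 / σ - ε) * H ^ (σ * ε) := by gcongr
    _ = (H ^ (1 - σ * ε) * H ^ (σ * ε)) * m := by field_simp
    _ = H * m := by rw [h3]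

/-- The condition is applied to `B`, which is at most `H ^ σ`. When `B = 0` the slope is a nonzero
integer. -/
theorem DiophantineCondition.slopeOrConstBounded {σ ε a b i : ℝ} (hσ : 0 < σ) (hε : ε ≤ 1 / σ)
    (h : DiophantineCondition σ ε a b) : SlopeOrConstBounded 1 0 a b i σ (σ * ε) := by
  obtain ⟨κ, hκ, h⟩ := h.exists_le_int
  refine ⟨κ, hκ, fun H hH A B C h0 hA hB => ?_⟩
  by_cases hB0 : B = 0
  · left
    subst hB0
    have hA0 : A ≠ 0 := fun hA0 => h0 ⟨hA0, rfl⟩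
    rw [Int.cast_zero, mul_zero, add_zero, one_mul]
    exact_mod_cast Int.one_le_abs hA0
  · right
    have h1 := mul_rpow_le_of_le hσ hε one_pos hH (le_max_of_le_left (abs_nonneg _)) (abs_nonneg _)
      (by rwa [one_mul]) (h B A C hB0)
    rw [Real.one_rpow, div_one] at h1
    refine h1.trans (le_of_eq ?_)
    congr 3 <;> ring_nf

/-- Here the condition concerns `A`, which is only known to be at most `H ^ i`. A slope below `1`
ties `a * A` to `B`, and so brings `A` down to order `H ^ σ`. -/
theorem DiophantineCondition.slopeOrConstBounded_swap {σ ε a b i : ℝ} (hσ : 0 < σ)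
    (hε : ε ≤ 1 / σ) (ha : a ≠ 0) (h : DiophantineCondition σ ε a b) :
    SlopeOrConstBounded a b 1 0 i σ (σ * ε) := by
  obtain ⟨κ, hκ, h⟩ := h.exists_le_int
  have ha0 : 0 < |a| := abs_pos.2 ha
  refine ⟨κ / (2 / |a|) ^ (1 / σ - ε), by positivity, fun H hH A B C h0 hA hB => ?_⟩
  by_cases hs : 1 ≤ |a * A + 1 * B|
  · exact Or.inl hs
  right
  rw [not_le] at hs
  have hA0 : A ≠ 0 := by
    rintro rfl
    have hB0 : B ≠ 0 := fun hB0 => h0 ⟨rfl, hB0⟩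
    rw [Int.cast_zero, mul_zero, zero_add, one_mul] at hs
    have : (1 : ℝ) ≤ |(B : ℝ)| := by exact_mod_cast Int.one_le_abs hB0
    linarith
  have hAL : |(A : ℝ)| ≤ 2 / |a| * H ^ σ := by
    have h1 := abs_sub (a * A + 1 * B) (B : ℝ)
    rw [one_mul, add_sub_cancel_right, abs_mul] at h1
    rw [one_mul] at hs
    have h2 : 1 ≤ H ^ σ := Real.one_le_rpow hH hσ.le
    rw [div_mul_eq_mul_div, le_div_iff₀ ha0]
    linarith
  have h1 := mul_rpow_le_of_le hσ hε (by positivity : 0 < 2 / |a|) hH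
    (le_max_of_le_left (abs_nonneg _)) (abs_nonneg _) hAL (h A B C hA0)
  refine h1.trans (le_of_eq ?_)
  congr 3 <;> ring_nf

/-- The construction wants the larger exponent first, so the coordinates are exchanged when `i ≤ j`.
-/
theorem isAlphaWinning_badParam {i j a b : ℝ} (hi0 : 0 < i) (hj0 : 0 < j) (hij : i + j = 1)
    (h₁ : j ≤ i → ∃ ε, 0 < ε ∧ FormsBoundedBelow 1 0 a b i j ε)
    (h₂ : i ≤ j → ∃ ε, 0 < ε ∧ FormsBoundedBelow a b 1 0 j i ε) (ha : a ≠ 0) (γ δ : ℝ) :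
    IsAlphaWinning (1 / 2) (badParam 1 0 a b γ δ i j) := by
  intro β hβ0 hβ1
  rcases le_total j i with hji | hji
  · obtain ⟨ε, hε, h⟩ := h₁ hji
    exact isAlphaBetaWinning_badParam hβ0 hβ1 hj0 hji hij one_ne_zero hε h γ δ
  · obtain ⟨ε, hε, h⟩ := h₂ hji
    have := isAlphaBetaWinning_badParam hβ0 hβ1 hi0 hji (by linarith) ha hε h δ γ
    convert this using 1
    simp only [badParam, max_comm]

theorem DiophantineCondition.anti {σ ε ε' a b : ℝ} (hε : ε' ≤ ε)
    (h : DiophantineCondition σ ε a b) : DiophantineCondition σ ε' a b := by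
  refine lt_of_lt_of_le h (liminf_le_liminf ?_)
  filter_upwards [eventually_ge_atTop 1] with q hq
  have hq1 : (1 : ℝ) ≤ q := by exact_mod_cast hq
  have := le_max_of_le_left (b := distInt (q * a)) (c := distInt (q * b)) (distInt_nonneg (q * a))
  apply EReal.coe_le_coe
  gcongr

theorem formsBoundedBelow_of_diophantineCondition {σ ε a b i : ℝ} (hσ : 0 < σ) (hε : 0 < ε)
    (ha : a ≠ 0) (h : DiophantineCondition σ ε a b) :
    (∃ ε, 0 < ε ∧ FormsBoundedBelow 1 0 a b i σ ε) ∧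
      ∃ ε, 0 < ε ∧ FormsBoundedBelow a b 1 0 i σ ε := by
  have h' := h.anti (min_le_left ε (1 / σ))
  have hε' : 0 < min ε (1 / σ) := lt_min hε (by positivity)
  have hle : min ε (1 / σ) ≤ 1 / σ := min_le_right _ _
  have hε1 : σ * min ε (1 / σ) ≤ 1 := by
    rw [le_div_iff₀ hσ] at hle
    linarith
  have hpos := mul_pos hσ hε'
  exact ⟨⟨_, hpos, (h'.slopeOrConstBounded hσ hle).formsBoundedBelow hpos hε1⟩,
    ⟨_, hpos, (h'.slopeOrConstBounded_swap hσ hle ha).formsBoundedBelow hpos hε1⟩⟩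

/-- For rational `a` all slopes are multiples of one over its denominator, so they form a discrete
set. -/
theorem formsBoundedBelow_of_rational {σ a b i : ℝ} (hσ : 0 < σ)
    (ha : a ≠ 0) (hr : ∃ r : ℚ, (r : ℝ) = a) (h : DiophantineCondition σ 0 a b) :
    (∃ ε, 0 < ε ∧ FormsBoundedBelow 1 0 a b i σ ε) ∧
      ∃ ε, 0 < ε ∧ FormsBoundedBelow a b 1 0 i σ ε := by
  obtain ⟨r, hr⟩ := hr
  have hd0 : (0 : ℝ) < r.den := by exact_mod_cast r.den_pos
  have hdisc : ∀ A B : ℤ, A + a * B = 0 ∨ (r.den : ℝ)⁻¹ ≤ |A + a * B| := by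
    intro A B
    have e : A + a * B = ((A * r.den + r.num * B : ℤ) : ℝ) / r.den := by
      have : a = r.num / r.den := by rw [← hr]; exact_mod_cast (Rat.num_div_den r).symm
      rw [this]
      push_cast
      field_simp
    rw [e]
    by_cases h0 : A * r.den + r.num * B = 0
    · left
      rw [h0, Int.cast_zero, zero_div]
    · right
      rw [abs_div, abs_of_pos hd0, inv_eq_one_div]
      gcongr
      exact_mod_cast Int.one_le_abs h0
  have hσ' : (0 : ℝ) ≤ 1 / σ := by positivity
  have h1 := h.slopeOrConstBounded (i := i) hσ hσ'
  have h2 := h.slopeOrConstBounded_swap (i := i) hσ hσ' ha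
  rw [mul_zero] at h1 h2
  refine ⟨⟨1, one_pos, h1.formsBoundedBelow_of_discrete (inv_pos.2 hd0) fun A B => ?_⟩,
    ⟨1, one_pos, h2.formsBoundedBelow_of_discrete (inv_pos.2 hd0) fun A B => ?_⟩⟩
  · rw [one_mul]
    exact hdisc A B
  · rw [one_mul, add_comm]
    exact hdisc B A

/-! ### Back to the line in the plane -/

theorem mem_bad_line_iff {θ : EuclideanSpace ℝ (Fin 2)} {i j a b : ℝ}
    {p : EuclideanSpace ℝ (Fin 2)} (hp : p ∈ line a b) :
    p ∈ Bad θ i j ↔ p 0 ∈ badParam 1 0 a b (θ 0) (θ 1) i j := by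
  have hp : p 1 = a * p 0 + b := hp
  simp only [Bad, badParam, Set.mem_ofPred_eq, hp, one_mul, add_zero]

/-- The parametrization of a line by its first coordinate. -/
noncomputable def lineEquiv (a b : ℝ) : ℝ ≃ line a b where
  toFun t := ⟨!₂[t, a * t + b], by simp [line]⟩
  invFun p := p.1 0
  left_inv t := by simp
  right_inv p := by
    have hp : p.1 1 = a * p.1 0 + b := p.2
    ext k
    fin_cases k <;> simp [hp]

theorem dist_lineEquiv (a b s t : ℝ) :
    dist (lineEquiv a b s) (lineEquiv a b t) = √(1 + a ^ 2) * dist s t := by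
  rw [Subtype.dist_eq, EuclideanSpace.dist_eq, Fin.sum_univ_two, Real.dist_eq s t,
    ← Real.sqrt_sq (abs_nonneg (s - t)), ← Real.sqrt_mul (by positivity)]
  have h0 : ∀ t, (lineEquiv a b t).1 0 = t := fun _ => rfl
  have h1 : ∀ t, (lineEquiv a b t).1 1 = a * t + b := fun _ => rfl
  rw [h0, h0, h1, h1, Real.dist_eq, Real.dist_eq, sq_abs, sq_abs]
  congr 1
  ring

theorem winning_of_isAlphaWinning_badParam {i j a b : ℝ} (θ : EuclideanSpace ℝ (Fin 2))
    (h : IsAlphaWinning (1 / 2) (badParam 1 0 a b (θ 0) (θ 1) i j)) :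
    IsWinning ((↑) ⁻¹' Bad θ i j : Set (line a b)) ∧
      IsAlphaWinning (1 / 2) ((fun p : EuclideanSpace ℝ (Fin 2) => p 0) ''
        (Bad θ i j ∩ line a b)) := by
  constructor
  · refine ⟨1 / 2, by norm_num, by norm_num, fun β hβ0 hβ1 => ?_⟩
    refine IsAlphaBetaWinning.of_similarity (e := lineEquiv a b) (by positivity)
      (dist_lineEquiv a b) ?_
    convert h β hβ0 hβ1 using 1
    ext t
    exact mem_bad_line_iff (lineEquiv a b t).2
  · convert h using 1
    ext t
    constructor
    · rintro ⟨p, ⟨hp, hpl⟩, rfl⟩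
      exact (mem_bad_line_iff hpl).1 hp
    · intro ht
      exact ⟨(lineEquiv a b t).1, ⟨(mem_bad_line_iff (lineEquiv a b t).2).2 ht,
        (lineEquiv a b t).2⟩, rfl⟩

theorem theorem2 (i j : ℝ) (hi0 : 0 < i) (hi1 : i < 1) (hj0 : 0 < j) (hj1 : j < 1)
    (hij : i + j = 1) (a b : ℝ) (ha : a ≠ 0) :
    ((∃ ε : ℝ, 0 < ε ∧ DiophantineCondition (min i j) ε a b) →
      ∀ θ : EuclideanSpace ℝ (Fin 2),
        IsWinning ((↑) ⁻¹' Bad θ i j : Set (line a b)) ∧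
        IsAlphaWinning (1 / 2) ((fun p : EuclideanSpace ℝ (Fin 2) => p 0) ''
          (Bad θ i j ∩ line a b))) ∧
    ((∃ r : ℚ, (r : ℝ) = a) → DiophantineCondition (min i j) 0 a b →
      ∀ θ : EuclideanSpace ℝ (Fin 2),
        IsWinning ((↑) ⁻¹' Bad θ i j : Set (line a b)) ∧
        IsAlphaWinning (1 / 2) ((fun p : EuclideanSpace ℝ (Fin 2) => p 0) ''
          (Bad θ i j ∩ line a b))) := by
  constructor
  · rintro ⟨ε, hε, h⟩ θ
    refine winning_of_isAlphaWinning_badParam θ (isAlphaWinning_badParam hi0 hj0 hij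
      (fun hji => ?_) (fun hji => ?_) ha _ _)
    · rw [min_eq_right hji] at h
      exact (formsBoundedBelow_of_diophantineCondition hj0 hε ha h).1
    · rw [min_eq_left hji] at h
      exact (formsBoundedBelow_of_diophantineCondition hi0 hε ha h).2
  · intro hr h θ
    refine winning_of_isAlphaWinning_badParam θ (isAlphaWinning_badParam hi0 hj0 hij
      (fun hji => ?_) (fun hji => ?_) ha _ _)
    · rw [min_eq_right hji] at h
      exact (formsBoundedBelow_of_rational hj0 ha hr h).1
    · rw [min_eq_left hji] at h
      exact (formsBoundedBelow_of_rational hi0 ha hr h).2
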